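/- **Proposition 3.2 (uniqueness).** Let $\mathcal O\subset\mathbb R^2$ be a bounded open set (for instance a bounded domain with smooth boundary), $T,\nu,\varepsilon>0$, let $w_1,w_2,\dots$ be independent standard real Wiener processes on a filtered probability space $(\Omega,\Sigma,(\Sigma_t),P)$, and let $\mathbf f\in L^2(0,T;\mathbb H^{-1}(\mathcal O))$ and $\mathbf g=(\mathbf g_k)_k\in L^2(0,T;\ell_2(\mathbb L^2(\mathcal O)))$ be deterministic. Here $\mathbb L^2(\mathcal O)=L^2(\mathcal O;\mathbb R^2)$ with norm $|\cdot|$ (also used for the norm of $L^2(\mathcal O)$), $\mathbb H^1_0(\mathcal O)=H^1_0(\mathcal O;\mathbb R^2)$, $\mathbb H^{-1}(\mathcal O)$ is the dual of $\mathbb H^1_0(\mathcal O)$, $(\cdot,\cdot)$ is the $L^2$ inner product and $\langle\cdot,\cdot\rangle$ the duality it induces. A *solution* is a pair $(\mathbf u,p)$ of adapted processes with $$\mathbf u\in L^2\big(\Omega;C^0([0,T];\mathbb L^2(\mathcal O))\cap L^2(0,T;\mathbb H^1_0(\mathcal O))\big),\qquad p\in L^2(\Omega\times\mathcal O\times(0,T)),$$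 such that for every $\boldsymbol\varphi\in\mathbb H^1_0(\mathcal O)$ and every $t\in[0,T]$, almost surely, $$(\mathbf u(t),\boldsymbol\varphi)-(\mathbf u(0),\boldsymbol\varphi)+\int_0^t\big\langle-\nu\Delta\mathbf u+[(\mathbf u\cdot\nabla)+\tfrac12\operatorname{Div}\mathbf u]\mathbf u+\nabla p,\ \boldsymbol\varphi\big\rangle\,ds=\int_0^t\langle\mathbf f,\boldsymbol\varphi\rangle\,ds+\sum_k\int_0^t(\mathbf g_k,\boldsymbol\varphi)\,dw_k(s),$$ where $\langle-\Delta\mathbf u,\boldsymbol\varphi\rangle=\sum_{i,j}\int_{\mathcal O}\partial_iu_j\,\partial_i\varphi_j\,dx$ and $\langle\nabla p,\boldsymbol\varphi\rangle=-\int_{\mathcal O}p\,\operatorname{Div}\boldsymbol\varphi\,dx$, and such that for every $\eta\in L^2(\mathcal O)$, almost surely, for all $t\in[0,T]$, $$\varepsilon(p(t),\eta)+\int_0^t(\operatorname{Div}\mathbf u(s),\eta)\,ds=\varepsilon(p(0),\eta).$$ No initial condition is part of this definition. Let $(\mathbf u,p)$ and $(\mathbf v,q)$ be two solutions, for the same data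 $\mathbf f,\mathbf g,w$, $\nu$, $\varepsilon$ and on the same probability space. 1. If $\mathbf u\in\mathbb L^4(\Omega\times\mathcal O\times(0,T))$, then almost surely, for all $t\in[0,T]$, $$\big[|\mathbf u(t)-\mathbf v(t)|^2+\varepsilon|p(t)-q(t)|^2\big]\exp\Big[-\frac{27}{\nu^3}\int_0^t\|\mathbf u(s)\|_{\mathbb L^4(\mathcal O)}^4\,ds\Big]\le|\mathbf u(0)-\mathbf v(0)|^2+\varepsilon|p(0)-q(0)|^2 .$$ 2. Solutions (in particular strong solutions) are pathwise unique: if almost surely $\mathbf u(0)=\mathbf v(0)$ and $p(0)=q(0)$, then almost surely $\mathbf u(t)=\mathbf v(t)$ and $p(t)=q(t)$ for all $t\in[0,T]$. -/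

import Mathlib

open MeasureTheory ProbabilityTheory Set Filter Topology
open scoped NNReal ENNReal

namespace ArtComp

noncomputable section

/-! ### Function spaces on an open set of the plane -/

/-- The Euclidean plane. -/
abbrev Plane : Type := EuclideanSpace ℝ (Fin 2)

/-- `2 × 2` arrays with the Frobenius norm; the entry `(i, j)` of a gradient is `∂ᵢ uⱼ`. -/
abbrev Grad : Type := EuclideanSpace ℝ (Fin 2 × Fin 2)

/-- `L²(O, ℝ²)`. -/
abbrev L2v (O : Set Plane) : Type := Lp Plane 2 (volume.restrict O)

/-- `L²(O, ℝ²ˣ²)`. -/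
abbrev L2g (O : Set Plane) : Type := Lp Grad 2 (volume.restrict O)

/-- `L²(O)`. -/
abbrev L2s (O : Set Plane) : Type := Lp ℝ 2 (volume.restrict O)

/-- The classical gradient of a vector field, with entries `∂ᵢ φⱼ`. -/
def classicalGrad (φ : Plane → Plane) (x : Plane) : Grad :=
  WithLp.toLp 2 fun ij => fderiv ℝ φ x (EuclideanSpace.single ij.1 1) ij.2

/-- The pairs `(φ, ∇φ)` in `L² × L²`, for `φ` smooth with compact support in `O`. -/
def testPairs (O : Set Plane) : Set (WithLp 2 (L2v O × L2g O)) :=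
  {z | ∃ φ : Plane → Plane, ContDiff ℝ (⊤ : ℕ∞) φ ∧ HasCompactSupport φ ∧ tsupport φ ⊆ O ∧
    (z.fst : Plane → Plane) =ᵐ[volume.restrict O] φ ∧
    (z.snd : Plane → Grad) =ᵐ[volume.restrict O] classicalGrad φ}

/-- `H¹₀(O, ℝ²)`: the closure of the smooth compactly supported fields in the `H¹` norm
`(|u|² + |∇u|²)^{1/2}`. A field is stored together with its weak gradient. -/
def H10Submodule (O : Set Plane) : Submodule ℝ (WithLp 2 (L2v O × L2g O)) :=
  (Submodule.span ℝ (testPairs O)).topologicalClosure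

/-- The Hilbert space `H¹₀(O, ℝ²)`. -/
abbrev H10 (O : Set Plane) : Type := ↥(H10Submodule O)

variable {O : Set Plane}

/-- The inclusion `H¹₀ ⊆ L²`. -/
def H10.val (U : H10 O) : L2v O := (U : WithLp 2 (L2v O × L2g O)).fst

/-- The weak gradient. -/
def H10.grad (U : H10 O) : L2g O := (U : WithLp 2 (L2v O × L2g O)).snd

/-- The divergence, as a function on the plane. -/
def H10.div (U : H10 O) (x : Plane) : ℝ := ∑ i : Fin 2, U.grad x (i, i)

/-- `⟨η, Div U⟩ = ∫_O η Div U dx`. -/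
def pairDiv (η : L2s O) (U : H10 O) : ℝ := ∫ x in O, η x * U.div x

/-- `⟨[(U·∇) + ½ Div U] V, W⟩ = ∫_O (∑ᵢⱼ Uᵢ ∂ᵢVⱼ Wⱼ + ½ (Div U) ∑ⱼ Vⱼ Wⱼ) dx`. -/
def convForm (U V W : H10 O) : ℝ :=
  ∫ x in O, ((∑ i : Fin 2, ∑ j : Fin 2, U.val x i * V.grad x (i, j) * W.val x j) +
    (1 / 2) * U.div x * ∑ j : Fin 2, V.val x j * W.val x j)

/-- The norm of `L⁴(O, ℝ²)`, with values in `[0, ∞]`. -/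
def eL4norm (u : L2v O) : ℝ≥0∞ := eLpNorm (u : Plane → Plane) 4 (volume.restrict O)

/-- The norm of `L⁴(O, ℝ²)` as a real number; it is used for fields in `L⁴`. -/
def L4norm (u : L2v O) : ℝ := (eL4norm u).toReal

/-! ### The driving noise and its integral -/

variable {Ω : Type*} [mΩ : MeasurableSpace Ω]

/-- A sequence of independent standard real Wiener processes relative to the filtration `ℱ`. -/
structure IsWienerFamily (P : Measure Ω) (ℱ : Filtration ℝ≥0 mΩ) (w : ℕ → ℝ≥0 → Ω → ℝ) :
    Prop where
  brownian : ∀ k, IsBrownianReal (w k) P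
  indep : iIndepFun (fun (k : ℕ) (ω : Ω) (t : ℝ≥0) => w k t ω) P
  adapted : ∀ k t, StronglyMeasurable[ℱ t] (w k t)
  increments : ∀ s : ℝ≥0, Indep (ℱ s)
    (MeasurableSpace.comap
      (fun (ω : Ω) (kr : ℕ × ℝ≥0) => w kr.1 (s + kr.2) ω - w kr.1 s ω) inferInstance) P

/-- A deterministic elementary `ℓ²`-valued integrand on `(0, t]`: the finite sum over `i` of
`coef i • 1_(left i, right i]` placed in the component `idx i`. -/
structure StepIntegrand (t : ℝ≥0) where
  n : ℕ
  idx : Fin n → ℕ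
  left : Fin n → ℝ≥0
  right : Fin n → ℝ≥0
  coef : Fin n → ℝ
  left_le : ∀ i, left i ≤ right i
  right_le : ∀ i, right i ≤ t

/-- The `k`-th component of an elementary integrand at time `s`. -/
def StepIntegrand.eval {t : ℝ≥0} (θ : StepIntegrand t) (k : ℕ) (s : ℝ) : ℝ :=
  ∑ i : Fin θ.n, if θ.idx i = k then
    (Ioc (θ.left i : ℝ) (θ.right i : ℝ)).indicator (fun _ => θ.coef i) s else 0

/-- The integral of an elementary integrand, `∑ᵢ coef i (w(right i) - w(left i))`. -/
def StepIntegrand.integral {t : ℝ≥0} (θ : StepIntegrand t) (w : ℕ → ℝ≥0 → Ω → ℝ) (ω : Ω) : ℝ :=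
  ∑ i : Fin θ.n, θ.coef i * (w (θ.idx i) (θ.right i) ω - w (θ.idx i) (θ.left i) ω)

/-- `X` is (a version of) the Itô integral `∑ₖ ∫₀ᵗ hₖ(s) dwₖ(s)` of the deterministic integrand
`h ∈ L²(0, t; ℓ²)`: the `L²(Ω)`-limit of integrals of elementary integrands that converge to `h`
in `L²(0, t; ℓ²)`. -/
def IsItoIntegral (P : Measure Ω) (w : ℕ → ℝ≥0 → Ω → ℝ) (h : ℕ → ℝ → ℝ) (t : ℝ≥0)
    (X : Ω → ℝ) : Prop :=
  AEStronglyMeasurable X P ∧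
  ∃ θ : ℕ → StepIntegrand t,
    Tendsto (fun n => ∑' k, ∫⁻ s in Ioc 0 (t : ℝ), ‖h k s - (θ n).eval k s‖ₑ ^ 2) atTop (𝓝 0) ∧
    Tendsto (fun n => eLpNorm (fun ω => X ω - (θ n).integral w ω) 2 P) atTop (𝓝 0)

/-! ### Solutions -/

/-- `(u, p)` is a solution on `[0, T]` of the stochastic Navier-Stokes system with artificial
compressibility, in variational form:
`d(u, φ) + ⟨-ν Δu + [(u·∇) + ½ Div u] u + ∇p, φ⟩ dt = ⟨f, φ⟩ dt + ∑ₖ (gₖ, φ) dwₖ` for all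
`φ ∈ H¹₀`, and `⟨ε ṗ + Div u, η⟩ = 0` for all `η ∈ L²`, where
`u ∈ L²(Ω; C⁰([0,T]; L²) ∩ L²(0,T; H¹₀))` and `p ∈ L²(Ω × O × (0,T))` are adapted.
Both equations are integrated in time. No initial condition is imposed. -/
structure IsSolution (P : Measure Ω) (ℱ : Filtration ℝ≥0 mΩ) (w : ℕ → ℝ≥0 → Ω → ℝ)
    (T ν ε : ℝ) (f : ℝ → StrongDual ℝ (H10 O)) (g : ℝ → lp (fun _ : ℕ => L2v O) 2)
    (u : ℝ → Ω → L2v O) (p : ℝ → Ω → L2s O) : Prop where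
  adapted_u : ∀ t : ℝ≥0, (t : ℝ) ≤ T → StronglyMeasurable[ℱ t] (u t)
  adapted_p : ∀ t : ℝ≥0, (t : ℝ) ≤ T → StronglyMeasurable[ℱ t] (p t)
  continuous_u : ∀ᵐ ω ∂P, ContinuousOn (fun t => u t ω) (Icc 0 T)
  sup_u : ∫⁻ ω, (⨆ t ∈ Icc (0 : ℝ) T, ‖u t ω‖ₑ ^ 2) ∂P < ⊤
  memLp_p : MemLp (fun z : Ω × ℝ => p z.2 z.1) 2 (P.prod (volume.restrict (Ioc 0 T)))
  /-- `U` is `u` regarded as an element of `L²(Ω × (0,T); H¹₀)`. -/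
  equations : ∃ U : ℝ → Ω → H10 O,
    MemLp (fun z : Ω × ℝ => U z.2 z.1) 2 (P.prod (volume.restrict (Ioc 0 T))) ∧
    (∀ᵐ z ∂(P.prod (volume.restrict (Ioc 0 T))), (U z.2 z.1).val = u z.2 z.1) ∧
    (∀ φ : H10 O, ∀ t : ℝ≥0, (t : ℝ) ≤ T →
      IsItoIntegral P w (fun k s => inner ℝ (g s k) φ.val) t
        (fun ω => inner ℝ (u t ω) φ.val - inner ℝ (u 0 ω) φ.val +
          ∫ s in (0 : ℝ)..t, (ν * inner ℝ (U s ω).grad φ.grad +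
            convForm (U s ω) (U s ω) φ - pairDiv (p s ω) φ - f s φ))) ∧
    (∀ η : L2s O, ∀ᵐ ω ∂P, ∀ t ∈ Icc (0 : ℝ) T,
      ε * inner ℝ (p t ω) η + ∫ s in (0 : ℝ)..t, pairDiv η (U s ω) = ε * inner ℝ (p 0 ω) η)

end

end ArtComp

open ArtComp

namespace ArtComp

/-! ### Itô isometry for deterministic integrands -/

section ItoIntegral

variable {Ω : Type*} [mΩ : MeasurableSpace Ω]

/-! The noise is additive and common to both solutions, so it drops out of the difference, and what
remains is a deterministic argument on almost every path. The stochastic integral is determined only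
up to a null set depending on the test field and the time. The Itô isometry identifies any two
versions (`IsItoIntegral.ae_eq`), and separability of `H10 O` with continuity in time reduces the
null sets to countably many (`evolution_equation_of_dense`).

Fix a path and write z = u - v, π = p - q, b for the convective form. Test the momentum difference
with z and the pressure difference with π: in the balance of |z|² + ε|π|² the two terms in π Div z
cancel. The correction ½ Div makes b skew in its last two arguments (`convForm_skew`), hence
b(u,u,z) - b(v,v,z) = -b(z,z,u), which is at most 2 |∇z| ‖z‖₄ ‖u‖₄ in absolute value.
Ladyzhenskaya's inequality ‖z‖₄⁴ ≤ 8 |z|² |∇z|² (`eL4norm_pow_four_le`) and the weighted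
arithmetic-geometric inequality absorb the gradient into the viscosity and leave 27 ν⁻³ ‖u‖₄⁴ |z|²
(`dissipation_estimate`). Grönwall's inequality with an integrable rate concludes, and uniqueness is
the case of zero initial difference.

The delicate point is testing with z itself. These bounds place the convective part of z' only in
L^{4/3}(0,T; H⁻¹), so the usual duality identity for L²(0,T; H⁻¹) is not enough. `energy_identity`
assumes instead a bound in which the superlinear part carries a factor ‖φ‖^{1/2} in the L² norm.
Over a step h, ‖z(s+h)‖² - ‖z(s)‖² is the integral of the drift tested with z(s) + z(s+h). Replacing
this field by 2z(r) costs, after averaging in s, an error that vanishes with h: translations are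
continuous in L²(0,T; H¹₀), and z is uniformly continuous in L². -/

lemma volume_real_Ioc_inter_Ioc {a b c d : ℝ≥0} (hab : a ≤ b) (hcd : c ≤ d) :
    volume.real (Ioc (a : ℝ) b ∩ Ioc (c : ℝ) d) =
      ((min b d : ℝ≥0) : ℝ) - (min b c : ℝ≥0) - (min a d : ℝ≥0) + (min a c : ℝ≥0) := by
  rw [Ioc_inter_Ioc, Real.volume_real_Ioc]
  have h1 : (a : ℝ) ≤ b := hab
  have h2 : (c : ℝ) ≤ d := hcd
  simp only [NNReal.coe_min]
  rcases le_total (b : ℝ) d with h | h <;> rcases le_total (b : ℝ) c with h' | h' <;>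
    rcases le_total (a : ℝ) d with h3 | h3 <;> rcases le_total (a : ℝ) c with h4 | h4 <;>
    simp only [min_def, max_def] <;> split_ifs <;> linarith

variable {P : Measure Ω} {ℱ : Filtration ℝ≥0 mΩ} {w : ℕ → ℝ≥0 → Ω → ℝ}

lemma IsWienerFamily.memLp (hw : IsWienerFamily P ℱ w) (k : ℕ) (t : ℝ≥0) :
    MemLp (w k t) 2 P :=
  (hw.brownian k).hasLaw_eval t |>.hasGaussianLaw.memLp_two

lemma IsWienerFamily.memLp_integral (hw : IsWienerFamily P ℱ w) {t : ℝ≥0}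
    (θ : StepIntegrand t) : MemLp (θ.integral w) 2 P :=
  memLp_finsetSum _ fun _ _ => ((hw.memLp _ _).sub (hw.memLp _ _)).const_mul _

variable [IsProbabilityMeasure P]

/-- For equal indices, bilinearity and cov(w(s), w(t)) = min s t give four minima, whose alternating
sum is the length of the overlap. For distinct indices the whole paths are independent. -/
lemma IsWienerFamily.covariance_increments (hw : IsWienerFamily P ℱ w) (k m : ℕ)
    {a b c d : ℝ≥0} (hab : a ≤ b) (hcd : c ≤ d) :
    cov[fun ω => w k b ω - w k a ω, fun ω => w m d ω - w m c ω; P] =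
      if k = m then volume.real (Ioc (a : ℝ) b ∩ Ioc (c : ℝ) d) else 0 := by
  split_ifs with h
  · subst h
    rw [covariance_fun_sub_fun_sub (hw.memLp k b) (hw.memLp k a) (hw.memLp k d) (hw.memLp k c),
      (hw.brownian k).covariance_eval, (hw.brownian k).covariance_eval,
      (hw.brownian k).covariance_eval, (hw.brownian k).covariance_eval,
      volume_real_Ioc_inter_Ioc hab hcd]
  · have hind := hw.indep.indepFun h
    have := hind.comp (φ := fun x : ℝ≥0 → ℝ => x b - x a) (ψ := fun x : ℝ≥0 → ℝ => x d - x c)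
      (by fun_prop) (by fun_prop)
    exact this.covariance_eq_zero ((hw.memLp k b).sub (hw.memLp k a))
      ((hw.memLp m d).sub (hw.memLp m c))

/-- The Itô isometry for finite sums of weighted increments. -/
lemma IsWienerFamily.eLpNorm_sum_increments (hw : IsWienerFamily P ℱ w) {ι : Type*} [Fintype ι]
    (k : ι → ℕ) (l r : ι → ℝ≥0) (a : ι → ℝ) (t : ℝ≥0) (hlr : ∀ i, l i ≤ r i)
    (hrt : ∀ i, r i ≤ t) :
    eLpNorm (fun ω => ∑ i, a i * (w (k i) (r i) ω - w (k i) (l i) ω)) 2 P ^ 2 =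
      ∑' m, ∫⁻ s in Ioc 0 (t : ℝ),
        ‖∑ i, if k i = m then (Ioc (l i : ℝ) (r i : ℝ)).indicator (fun _ => a i) s else 0‖ₑ ^ 2 := by
  classical
  set c : ι → ι → ℝ := fun i j =>
    if k i = k j then volume.real (Ioc (l i : ℝ) (r i) ∩ Ioc (l j : ℝ) (r j)) else 0 with hc
  have hmem : ∀ i, MemLp (fun ω => a i * (w (k i) (r i) ω - w (k i) (l i) ω)) 2 P := fun i =>
    ((hw.memLp _ _).sub (hw.memLp _ _)).const_mul (a i)
  have hS : MemLp (fun ω => ∑ i, a i * (w (k i) (r i) ω - w (k i) (l i) ω)) 2 P :=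
    memLp_finsetSum _ fun i _ => hmem i
  -- The mean vanishes, so the second moment is the covariance of the sum with itself.
  have hmean : ∫ ω, ∑ i, a i * (w (k i) (r i) ω - w (k i) (l i) ω) ∂P = 0 := by
    rw [integral_finsetSum _ fun i _ => (hmem i).integrable one_le_two]
    refine Finset.sum_eq_zero fun i _ => ?_
    rw [integral_const_mul, integral_sub ((hw.memLp _ _).integrable one_le_two)
      ((hw.memLp _ _).integrable one_le_two), (hw.brownian _).integral_eval,
      (hw.brownian _).integral_eval, sub_zero, mul_zero]
  have hL : eLpNorm (fun ω => ∑ i, a i * (w (k i) (r i) ω - w (k i) (l i) ω)) 2 P ^ 2 =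
      ENNReal.ofReal (∑ i, ∑ j, a i * a j * c i j) := by
    have h1 : ∫ ω, (∑ i, a i * (w (k i) (r i) ω - w (k i) (l i) ω)) ^ 2 ∂P =
        ∑ i, ∑ j, a i * a j * c i j := by
      have := covariance_fun_sum_fun_sum hmem hmem
      rw [covariance_eq_sub hS hS, hmean] at this
      simp only [mul_zero, sub_zero] at this
      simp_rw [sq]
      refine this.trans ?_
      refine Finset.sum_congr rfl fun i _ => Finset.sum_congr rfl fun j _ => ?_
      rw [covariance_const_mul_left, covariance_const_mul_right,
        hw.covariance_increments _ _ (hlr i) (hlr j)]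
      ring
    rw [← h1, ofReal_integral_eq_lintegral_ofReal hS.integrable_sq
      (Eventually.of_forall fun _ => sq_nonneg _),
      eLpNorm_eq_lintegral_rpow_enorm_toReal (by simp) (by simp)]
    rw [← ENNReal.rpow_natCast, ← ENNReal.rpow_mul]
    norm_num
    refine lintegral_congr fun ω => ?_
    rw [Real.enorm_eq_ofReal_abs, ← ENNReal.ofReal_pow (abs_nonneg _), sq_abs]
  rw [hL]
  set F : ℕ → ι → ℝ → ℝ := fun m i s =>
    if k i = m then (Ioc (l i : ℝ) (r i : ℝ)).indicator (fun _ => a i) s else 0 with hF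
  have hFF : ∀ m i j, (fun s => F m i s * F m j s) =
      (Ioc (l i : ℝ) (r i) ∩ Ioc (l j : ℝ) (r j)).indicator
        (fun _ => if k i = m ∧ k j = m then a i * a j else 0) := by
    intro m i j
    have hF' : ∀ i s, F m i s =
        (Ioc (l i : ℝ) (r i)).indicator (fun _ => if k i = m then a i else 0) s := by
      intro i s
      by_cases h : k i = m
      · simp only [hF, h, if_true]
      · simp only [hF, h, if_false, indicator_zero]
    ext s
    rw [hF', hF', ← inter_indicator_mul]
    congr 1
    ext _
    by_cases h : k i = m <;> by_cases h' : k j = m <;> simp [h, h']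
  have hfin : ∀ i j, volume (Ioc (l i : ℝ) (r i) ∩ Ioc (l j : ℝ) (r j)) ≠ ⊤ := fun i j =>
    ((measure_mono inter_subset_left).trans_lt (by simp)).ne
  have hint : ∀ m i j, IntegrableOn (fun s => F m i s * F m j s) (Ioc 0 (t : ℝ)) := by
    intro m i j
    rw [hFF]
    refine IntegrableOn.integrable_indicator ?_ (by measurability)
    exact integrableOn_const (((Measure.restrict_apply_le _ _).trans_lt (hfin i j).lt_top).ne)
  have hval : ∀ m i j, ∫ s in Ioc 0 (t : ℝ), F m i s * F m j s =
      if k i = m ∧ k j = m then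
        a i * a j * volume.real (Ioc (l i : ℝ) (r i) ∩ Ioc (l j : ℝ) (r j)) else 0 := by
    intro m i j
    rw [hFF, setIntegral_indicator (by measurability), setIntegral_const]
    have : Ioc 0 (t : ℝ) ∩ (Ioc (l i : ℝ) (r i) ∩ Ioc (l j : ℝ) (r j)) =
        Ioc (l i : ℝ) (r i) ∩ Ioc (l j : ℝ) (r j) := by
      refine inter_eq_right.2 fun s hs => ⟨(l i).2.trans_lt hs.1.1, hs.1.2.trans ?_⟩
      exact_mod_cast hrt i
    rw [this]
    split_ifs <;> simp [mul_comm]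
  have hsq : ∀ m, ∫⁻ s in Ioc 0 (t : ℝ), ‖∑ i, F m i s‖ₑ ^ 2 =
      ENNReal.ofReal (∑ i, ∑ j, if k i = m ∧ k j = m then
        a i * a j * volume.real (Ioc (l i : ℝ) (r i) ∩ Ioc (l j : ℝ) (r j)) else 0) := by
    intro m
    have h1 : ∀ s, (∑ i, F m i s) ^ 2 = ∑ i, ∑ j, F m i s * F m j s := fun s => by
      rw [sq, Finset.sum_mul_sum]
    have h2 : IntegrableOn (fun s => (∑ i, F m i s) ^ 2) (Ioc 0 (t : ℝ)) := by
      simp_rw [h1]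
      exact integrable_finsetSum _ fun i _ => integrable_finsetSum _ fun j _ => hint m i j
    simp_rw [← hval]
    have h3 : ∑ i, ∑ j, ∫ s in Ioc 0 (t : ℝ), F m i s * F m j s =
        ∫ s in Ioc 0 (t : ℝ), (∑ i, F m i s) ^ 2 := by
      simp_rw [h1]
      rw [integral_finsetSum _ fun i _ => integrable_finsetSum _ fun j _ => hint m i j]
      refine Finset.sum_congr rfl fun i _ => ?_
      rw [integral_finsetSum _ fun j _ => hint m i j]
    rw [h3, ofReal_integral_eq_lintegral_ofReal h2 (Eventually.of_forall fun _ => sq_nonneg _)]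
    refine lintegral_congr fun ω => ?_
    rw [Real.enorm_eq_ofReal_abs, ← ENNReal.ofReal_pow (abs_nonneg _), sq_abs]
  have hpos : ∀ m, 0 ≤ ∑ i, ∑ j, if k i = m ∧ k j = m then
        a i * a j * volume.real (Ioc (l i : ℝ) (r i) ∩ Ioc (l j : ℝ) (r j)) else 0 := by
    intro m
    have h1 : ∀ s, (∑ i, F m i s) ^ 2 = ∑ i, ∑ j, F m i s * F m j s := fun s => by
      rw [sq, Finset.sum_mul_sum]
    simp_rw [← hval]
    have h3 : ∑ i, ∑ j, ∫ s in Ioc 0 (t : ℝ), F m i s * F m j s =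
        ∫ s in Ioc 0 (t : ℝ), (∑ i, F m i s) ^ 2 := by
      simp_rw [h1]
      rw [integral_finsetSum _ fun i _ => integrable_finsetSum _ fun j _ => hint m i j]
      refine Finset.sum_congr rfl fun i _ => ?_
      rw [integral_finsetSum _ fun j _ => hint m i j]
    rw [h3]
    exact integral_nonneg fun _ => sq_nonneg _
  change _ = ∑' m, ∫⁻ s in Ioc 0 (t : ℝ), ‖∑ i, F m i s‖ₑ ^ 2
  simp_rw [hsq]
  -- Only components in the image of `k` contribute. Summing over `m` then leaves, for each pair
  -- `(i, j)`, the single term `m = k i`, present only when `k i = k j`.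
  rw [tsum_eq_sum (s := Finset.univ.image k), ← ENNReal.ofReal_sum_of_nonneg fun m _ => hpos m]
  · congr 1
    symm
    rw [Finset.sum_comm]
    refine Finset.sum_congr rfl fun i _ => ?_
    rw [Finset.sum_comm]
    refine Finset.sum_congr rfl fun j _ => ?_
    rw [Finset.sum_eq_single (k i)]
    · simp only [hc]
      by_cases h : k i = k j
      · simp [h]
      · simp [h, Ne.symm h]
    · intro m _ hm
      rw [if_neg]
      exact fun h => hm h.1.symm
    · intro h
      simp at h
  · intro m hm
    rw [ENNReal.ofReal_eq_zero]
    apply le_of_eq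
    apply Finset.sum_eq_zero
    intro i _
    apply Finset.sum_eq_zero
    intro j _
    rw [if_neg]
    rintro ⟨rfl, -⟩
    simp at hm

/-- A difference of two elementary integrals is again a weighted sum of increments, indexed by the
disjoint union with the second family of coefficients negated. -/
lemma IsWienerFamily.eLpNorm_integral_sub (hw : IsWienerFamily P ℱ w) {t : ℝ≥0}
    (θ θ' : StepIntegrand t) :
    eLpNorm (fun ω => θ.integral w ω - θ'.integral w ω) 2 P ^ 2 =
      ∑' m, ∫⁻ s in Ioc 0 (t : ℝ), ‖θ.eval m s - θ'.eval m s‖ₑ ^ 2 := by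
  have := hw.eLpNorm_sum_increments (Sum.elim θ.idx θ'.idx) (Sum.elim θ.left θ'.left)
    (Sum.elim θ.right θ'.right) (Sum.elim θ.coef (-θ'.coef)) t
    (by rintro (i | i); exacts [θ.left_le i, θ'.left_le i])
    (by rintro (i | i); exacts [θ.right_le i, θ'.right_le i])
  simp only [Fintype.sum_sum_type, Sum.elim_inl, Sum.elim_inr, Pi.neg_apply] at this
  simp only [StepIntegrand.integral, StepIntegrand.eval, sub_eq_add_neg _ (Finset.sum _ _)]
  simp only [neg_mul, Finset.sum_neg_distrib] at this
  have e : ∀ m s, -(∑ i, if θ'.idx i = m then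
        (Ioc (θ'.left i : ℝ) (θ'.right i)).indicator (fun _ => θ'.coef i) s else 0) =
      ∑ i, if θ'.idx i = m then
        (Ioc (θ'.left i : ℝ) (θ'.right i)).indicator (fun _ => -θ'.coef i) s else 0 := by
    intro m s
    rw [← Finset.sum_neg_distrib]
    refine Finset.sum_congr rfl fun i _ => ?_
    simp only [indicator]
    split_ifs <;> simp
  simp only [e]
  exact this

/-- Two versions of the Itô integral of the same integrand agree almost surely. -/
theorem IsItoIntegral.ae_eq (hw : IsWienerFamily P ℱ w) {h : ℕ → ℝ → ℝ} {t : ℝ≥0} {X Y : Ω → ℝ}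
    (hh : ∀ k, AEMeasurable (h k) (volume.restrict (Ioc 0 (t : ℝ))))
    (hX : IsItoIntegral P w h t X) (hY : IsItoIntegral P w h t Y) : X =ᵐ[P] Y := by
  obtain ⟨hXm, θ, hθ, hXθ⟩ := hX
  obtain ⟨hYm, θ', hθ', hYθ⟩ := hY
  have hmeas : ∀ (θ : StepIntegrand t) (k : ℕ), Measurable (θ.eval k) := by
    intro θ k
    refine Finset.measurable_sum _ fun i _ => ?_
    split_ifs
    · exact measurable_const.indicator measurableSet_Ioc
    · exact measurable_const
  have hsq : ∀ a b : ℝ, ‖a - b‖ₑ ^ 2 ≤ 2 * ‖a‖ₑ ^ 2 + 2 * ‖b‖ₑ ^ 2 := by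
    intro a b
    simp only [Real.enorm_eq_ofReal_abs]
    rw [← ENNReal.ofReal_pow (abs_nonneg _), ← ENNReal.ofReal_pow (abs_nonneg _),
      ← ENNReal.ofReal_pow (abs_nonneg _), ← ENNReal.ofReal_ofNat 2,
      ← ENNReal.ofReal_mul (by norm_num), ← ENNReal.ofReal_mul (by norm_num),
      ← ENNReal.ofReal_add (by positivity) (by positivity)]
    refine ENNReal.ofReal_le_ofReal ?_
    simp only [sq_abs]
    nlinarith [sq_nonneg (a + b)]
  -- Both step sequences approximate the same `h`, so they approach each other in L²(0,t; ℓ²); the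
  -- isometry transfers this to L²(Ω).
  have hdiff : Tendsto (fun n => eLpNorm (fun ω => (θ n).integral w ω - (θ' n).integral w ω) 2 P)
      atTop (𝓝 0) := by
    have h2 : Tendsto (fun n =>
        eLpNorm (fun ω => (θ n).integral w ω - (θ' n).integral w ω) 2 P ^ 2) atTop (𝓝 0) := by
      have hlim : Tendsto (fun n =>
          2 * (∑' k, ∫⁻ s in Ioc 0 (t : ℝ), ‖h k s - (θ' n).eval k s‖ₑ ^ 2) +
          2 * (∑' k, ∫⁻ s in Ioc 0 (t : ℝ), ‖h k s - (θ n).eval k s‖ₑ ^ 2)) atTop (𝓝 0) := by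
        have := (ENNReal.Tendsto.const_mul (a := 2) hθ' (Or.inr (by simp))).add
          (ENNReal.Tendsto.const_mul (a := 2) hθ (Or.inr (by simp)))
        simpa using this
      refine tendsto_of_tendsto_of_tendsto_of_le_of_le tendsto_const_nhds hlim
        (fun _ => zero_le) fun n => ?_
      simp only
      rw [hw.eLpNorm_integral_sub, ← ENNReal.tsum_mul_left, ← ENNReal.tsum_mul_left,
        ← ENNReal.tsum_add]
      refine ENNReal.tsum_le_tsum fun k => ?_
      have hm : AEMeasurable (fun s => 2 * ‖h k s - (θ' n).eval k s‖ₑ ^ 2)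
          (volume.restrict (Ioc 0 (t : ℝ))) :=
        (((hh k).sub (hmeas (θ' n) k).aemeasurable).enorm.pow_const 2).const_mul 2
      rw [← lintegral_const_mul' _ _ (by simp), ← lintegral_const_mul' _ _ (by simp),
        ← lintegral_add_left' hm]
      refine lintegral_mono fun s => ?_
      have := hsq (h k s - (θ' n).eval k s) (h k s - (θ n).eval k s)
      rwa [sub_sub_sub_cancel_left] at this
    have h3 := h2.ennrpow_const (1 / 2)
    refine (h3.congr fun n => ?_).trans (by simp)
    rw [← ENNReal.rpow_natCast, ← ENNReal.rpow_mul]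
    norm_num
  have hle : ∀ n, eLpNorm (fun ω => X ω - Y ω) 2 P ≤
      eLpNorm (fun ω => X ω - (θ n).integral w ω) 2 P +
      eLpNorm (fun ω => (θ n).integral w ω - (θ' n).integral w ω) 2 P +
      eLpNorm (fun ω => Y ω - (θ' n).integral w ω) 2 P := by
    intro n
    have m1 := hXm.sub (hw.memLp_integral (θ n)).aestronglyMeasurable
    have m2 := (hw.memLp_integral (θ n)).aestronglyMeasurable.sub
      (hw.memLp_integral (θ' n)).aestronglyMeasurable
    have m3 := hYm.sub (hw.memLp_integral (θ' n)).aestronglyMeasurable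
    have e : (fun ω => X ω - Y ω) = ((X - (θ n).integral w) +
        ((θ n).integral w - (θ' n).integral w)) - (Y - (θ' n).integral w) := by
      ext ω
      simp
    rw [e]
    exact (eLpNorm_sub_le (m1.add m2) m3 one_le_two).trans
      (add_le_add_left (eLpNorm_add_le m1 m2 one_le_two) _)
  have h0 : eLpNorm (fun ω => X ω - Y ω) 2 P = 0 := by
    have hlim := (hXθ.add hdiff).add hYθ
    simp only [add_zero] at hlim
    exact le_antisymm (ge_of_tendsto' hlim hle) zero_le
  filter_upwards [(eLpNorm_eq_zero_iff (f := fun ω => X ω - Y ω) (hXm.sub hYm) (by simp)).1 h0]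
    with ω hω
  exact sub_eq_zero.1 hω

end ItoIntegral

/-! ### Grönwall's inequality with an integrable rate -/

section Gronwall

lemma IntervalIntegrable.deriv_integral_ae_eq {f : ℝ → ℝ} {a b : ℝ}
    (hf : IntervalIntegrable f volume a b) :
    ∀ᵐ x, x ∈ uIcc a b → HasDerivAt (fun y => ∫ s in a..y, f s) (f x) x := by
  filter_upwards [hf.ae_hasDerivAt_integral] with x hx h
  exact hx h a (by simp)

/-- Being Lipschitz on the range of `f` suffices. This matters for the exponential, which is
Lipschitz only on bounded sets. -/
lemma LipschitzOnWith.comp_absolutelyContinuousOnInterval {K : ℝ≥0} {φ f : ℝ → ℝ} {s : Set ℝ}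
    {a b : ℝ} (hφ : LipschitzOnWith K φ s) (hf : AbsolutelyContinuousOnInterval f a b)
    (hfs : ∀ x ∈ uIcc a b, f x ∈ s) :
    AbsolutelyContinuousOnInterval (fun x => φ (f x)) a b := by
  unfold AbsolutelyContinuousOnInterval at hf ⊢
  refine squeeze_zero' (Eventually.of_forall fun E => Finset.sum_nonneg fun i _ => dist_nonneg) ?_
    (by simpa using hf.const_mul (K : ℝ))
  filter_upwards [mem_inf_of_right (mem_principal_self _)] with E hE
  rw [Finset.mul_sum]
  refine Finset.sum_le_sum fun i hi => ?_
  have := hE.1 i hi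
  exact hφ.dist_le_mul _ (hfs _ this.1) _ (hfs _ this.2)

/-- Grönwall's inequality with an integrable rate, for an absolutely continuous function. -/
theorem mul_exp_neg_integral_le {e a : ℝ → ℝ} {E0 t : ℝ} (ht : 0 ≤ t)
    (he : IntervalIntegrable e volume 0 t) (ha : IntervalIntegrable a volume 0 t)
    (hle : ∀ᵐ s, s ∈ Icc 0 t → e s ≤ a s * (E0 + ∫ r in (0 : ℝ)..s, e r)) :
    (E0 + ∫ s in (0 : ℝ)..t, e s) * Real.exp (-∫ s in (0 : ℝ)..t, a s) ≤ E0 := by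
  have hE : AbsolutelyContinuousOnInterval (fun x => E0 + ∫ s in (0 : ℝ)..x, e s) 0 t :=
    ((contDiffOn_const (c := E0)).absolutelyContinuousOnInterval).fun_add
      (he.absolutelyContinuousOnInterval_intervalIntegral (by simp))
  have hA : AbsolutelyContinuousOnInterval (fun x => ∫ s in (0 : ℝ)..x, a s) 0 t :=
    ha.absolutelyContinuousOnInterval_intervalIntegral (by simp)
  have hexp : AbsolutelyContinuousOnInterval
      (fun x => Real.exp (-∫ s in (0 : ℝ)..x, a s)) 0 t := by
    obtain ⟨C, hC⟩ := hA.exists_bound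
    have hL : LipschitzOnWith (Real.exp C).toNNReal (fun y => Real.exp (-y)) (Icc (-C) C) := by
      refine (convex_Icc _ _).lipschitzOnWith_of_nnnorm_hasDerivWithin_le
        (f' := fun y => Real.exp (-y) * (-1))
        (fun y _ => ((hasDerivAt_neg y).exp).hasDerivWithinAt) fun y hy => ?_
      rw [← NNReal.coe_le_coe, Real.coe_toNNReal _ (Real.exp_pos _).le, coe_nnnorm, mul_neg_one,
        norm_neg, Real.norm_eq_abs, Real.abs_exp, Real.exp_le_exp]
      linarith [hy.1]
    have hmem : ∀ x ∈ uIcc 0 t, (∫ s in (0 : ℝ)..x, a s) ∈ Icc (-C) C := fun x hx =>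
      abs_le.1 (hC x hx)
    exact LipschitzOnWith.comp_absolutelyContinuousOnInterval (φ := fun y => Real.exp (-y))
      (f := fun x => ∫ s in (0 : ℝ)..x, a s) hL hA hmem
  -- Since `e` and `a` are merely integrable, the product is differentiable only almost everywhere;
  -- absolute continuity still makes it the integral of its derivative, which is nonpositive by
  -- `hle`.
  have hmul := (hE.fun_mul hexp)
  have h1 := hmul.integral_deriv_eq_sub
  have h2 : ∫ x in (0 : ℝ)..t, deriv (fun x => (E0 + ∫ s in (0 : ℝ)..x, e s) *
      Real.exp (-∫ s in (0 : ℝ)..x, a s)) x ≤ ∫ x in (0 : ℝ)..t, (0 : ℝ) := by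
    refine intervalIntegral.integral_mono_ae_restrict ht hmul.intervalIntegrable_deriv
      (by simp) ?_
    rw [EventuallyLE, ae_restrict_iff' measurableSet_Icc]
    filter_upwards [hle, IntervalIntegrable.deriv_integral_ae_eq he,
      IntervalIntegrable.deriv_integral_ae_eq ha] with x h1 h2 h3 hx
    have hx' : x ∈ uIcc 0 t := by rwa [uIcc_of_le ht]
    have hd : HasDerivAt (fun x => (E0 + ∫ s in (0 : ℝ)..x, e s) *
        Real.exp (-∫ s in (0 : ℝ)..x, a s)) _ x :=
      ((h2 hx').const_add E0).mul ((h3 hx').neg.exp)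
    rw [hd.deriv]
    have := h1 hx
    have hp := Real.exp_pos (-∫ s in (0 : ℝ)..x, a s)
    simp only [Pi.neg_apply]
    nlinarith
  simp at h1 h2
  linarith

end Gronwall

/-! ### Energy identity for a weakly regular drift -/

section EnergyIdentity

lemma tendsto_eLpNorm_translate_sub {V : Type*} [NormedAddCommGroup V] {p : ℝ≥0∞} [Fact (1 ≤ p)]
    (hp : p ≠ ⊤) {W : ℝ → V} (hW : MemLp W p volume) :
    Tendsto (fun a : ℝ => eLpNorm (fun s => W (s + a) - W s) p volume) (𝓝 0) (𝓝 0) := by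
  set c : C(ℝ, C(ℝ, ℝ)) := (ContinuousMap.mk (fun a : ℝ × ℝ => a.2 + a.1) (by fun_prop)).curry
  have hc : ∀ a, MeasurePreserving (c a) volume volume := fun a =>
    measurePreserving_add_right volume a
  have h1 : Continuous fun a => Lp.compMeasurePreserving (c a) (hc a) (hW.toLp W) :=
    continuous_const.compMeasurePreservingLp c.continuous hc hp
  have h2 := (h1.tendsto 0)
  rw [tendsto_iff_edist_tendsto_0] at h2
  refine h2.congr fun a => ?_
  rw [Lp.toLp_compMeasurePreserving, Lp.toLp_compMeasurePreserving, Lp.edist_toLp_toLp]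
  congr 1
  ext s
  simp [c]

/-- The averaged increment telescopes to the mean of `ψ` over `(t, t+h)` minus its mean over `(0,
h)`. It thus recovers an increment of `ψ` from information available only for almost every `s`. -/
lemma tendsto_average_sub {ψ : ℝ → ℝ} (hψ : Continuous ψ) (t : ℝ) :
    Tendsto (fun h : ℝ => h⁻¹ * ∫ s in (0 : ℝ)..t, (ψ (s + h) - ψ s)) (𝓝[>] 0)
      (𝓝 (ψ t - ψ 0)) := by
  have hK : ∀ x, HasDerivAt (fun y => ∫ s in (0 : ℝ)..y, ψ s) (ψ x) x := fun x =>
    intervalIntegral.integral_hasDerivAt_right (hψ.intervalIntegrable _ _)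
      (hψ.stronglyMeasurableAtFilter _ _) hψ.continuousAt
  have hslope : ∀ x, Tendsto (fun h : ℝ => h⁻¹ *
      ((∫ s in (0 : ℝ)..(x + h), ψ s) - ∫ s in (0 : ℝ)..x, ψ s)) (𝓝[>] 0) (𝓝 (ψ x)) := by
    intro x
    have := (hasDerivAt_iff_tendsto_slope_zero.1 (hK x))
    exact this.mono_left (nhdsWithin_mono _ fun y hy => ne_of_gt hy)
  have := (hslope t).sub (hslope 0)
  refine this.congr fun h => ?_
  have hi : ∀ a b, IntervalIntegrable ψ volume a b := fun a b => hψ.intervalIntegrable a b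
  rw [intervalIntegral.integral_sub ((by fun_prop : Continuous fun s => ψ (s + h)).intervalIntegrable
    _ _) (hi _ _), intervalIntegral.integral_comp_add_right]
  have e1 := intervalIntegral.integral_add_adjacent_intervals (hi 0 (0 + h)) (hi (0 + h) (t + h))
  simp only [intervalIntegral.integral_same]
  rw [← e1]
  ring

variable {V H : Type*} [NormedAddCommGroup V] [NormedSpace ℝ V]
  [NormedAddCommGroup H] [InnerProductSpace ℝ H]

/-- The integrability of the pairing of a process with its drift, under a bound on the drift in
terms of the norms of `V` and of `H`. -/
lemma integrable_pairing_of_bound {μ : Measure ℝ} {j : V →L[ℝ] H} {W : ℝ → V}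
    {G : ℝ → StrongDual ℝ V} {β : ℝ → ℝ} {M : ℝ}
    (hW : MemLp W 2 μ) (hG : AEStronglyMeasurable G μ) (hβ : MemLp β 2 μ)
    (hM : ∀ᵐ s ∂μ, ‖j (W s)‖ ≤ M)
    (hGβ : ∀ᵐ s ∂μ, ∀ φ, |G s φ| ≤ β s * ‖φ‖ + √‖j φ‖ * (β s ^ 2 + ‖φ‖ ^ 2)) :
    Integrable (fun s => G s (W s)) μ := by
  have hW2 : Integrable (fun s => ‖W s‖ ^ 2) μ := hW.integrable_norm_pow two_ne_zero
  refine Integrable.mono' (g := fun s => (β s ^ 2 + ‖W s‖ ^ 2) + √M * (β s ^ 2 + ‖W s‖ ^ 2))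
    ((hβ.integrable_sq.add hW2).add ((hβ.integrable_sq.add hW2).const_mul _)) ?_ ?_
  · exact (ContinuousLinearMap.apply ℝ ℝ (E := V)).flip.aestronglyMeasurable_comp₂ hG hW.1
  · filter_upwards [hM, hGβ] with s h1 h2
    refine (h2 (W s)).trans (add_le_add ?_ ?_)
    · nlinarith [sq_nonneg (β s - ‖W s‖), sq_nonneg (β s), sq_nonneg ‖W s‖]
    · gcongr

lemma integral_norm_sq_eq {α E : Type*} [MeasurableSpace α] [NormedAddCommGroup E] {μ : Measure α}
    {f : α → E} (hf : AEStronglyMeasurable f μ) :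
    ∫ x, ‖f x‖ ^ 2 ∂μ = (eLpNorm f 2 μ).toReal ^ 2 := by
  rw [integral_eq_lintegral_of_nonneg_ae (Eventually.of_forall fun _ => sq_nonneg _)
    (hf.norm.pow 2), eLpNorm_eq_lintegral_rpow_enorm_toReal (by simp) (by simp),
    ← ENNReal.toReal_pow, ← ENNReal.rpow_natCast, ← ENNReal.rpow_mul]
  norm_num

/-- The linear part of the bound is handled by Young's inequality with a small weight on `β²`, the
remaining square being small by L² continuity of translations. The superlinear part has a bounded
integral, and its factor `√‖j φ‖` is small by uniform continuity of `w`. -/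
lemma lintegral_translate_le {T : ℝ} {w : ℝ → H} (hw : Continuous w) {j : V →L[ℝ] H} {W : ℝ → V}
    {G : ℝ → StrongDual ℝ V} {β : ℝ → ℝ} (hW : MemLp W 2 volume) (hβ : MemLp β 2 volume)
    (hGβ : ∀ᵐ s, ∀ φ, |G s φ| ≤ β s * ‖φ‖ + √‖j φ‖ * (β s ^ 2 + ‖φ‖ ^ 2))
    (hWw : ∀ᵐ s, s ∈ Ioc 0 T → j (W s) = w s) {t : ℝ} (ht : t < T) {κ : ℝ} (hκ : 0 < κ) :
    ∃ δ > 0, t + δ ≤ T ∧ ∀ θ ∈ Icc 0 δ, ∀ σ ∈ Icc 0 δ,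
      ∫⁻ s in Ioc 0 t, ‖G (s + θ) (W (s + θ) - W (s + σ))‖ₑ ≤ ENNReal.ofReal κ := by
  set N : ℝ := ∫ s, β s ^ 2 with hN
  have hN0 : 0 ≤ N := integral_nonneg fun _ => sq_nonneg _
  set D : ℝ → ℝ := fun a => ∫ s, ‖W (s + a) - W s‖ ^ 2 with hD
  have hsub : ∀ a, MemLp (fun s => W (s + a) - W s) 2 volume := fun a =>
    (hW.comp_measurePreserving (measurePreserving_add_right volume a)).sub hW
  have hDlim : Tendsto D (𝓝 0) (𝓝 0) := by
    have h1 := tendsto_eLpNorm_translate_sub (by simp) hW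
    have h3 := ((ENNReal.tendsto_toReal (by simp)).comp h1).pow 2
    simp only [ENNReal.toReal_zero, ne_eq, OfNat.ofNat_ne_zero, not_false_eq_true, zero_pow] at h3
    exact h3.congr fun a => (integral_norm_sq_eq (hsub a).1).symm
  -- With this weight and `D ≤ min 1 (κ₁ κ / 4)`, each of `κ₁ N`, `κ₁⁻¹ D` and `κ₁ (N + D)` is at
  -- most `κ / 4`.
  set κ₁ : ℝ := κ / (4 * (N + 1)) with hκ₁
  have hκ₁0 : 0 < κ₁ := by positivity
  have hκ₁N : κ₁ * (N + 1) = κ / 4 := by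
    rw [hκ₁]
    field_simp
  obtain ⟨δ₁, hδ₁, hD₁⟩ : ∃ δ₁ > 0, ∀ a, |a| < δ₁ → D a < min 1 (κ₁ * (κ / 4)) := by
    have := hDlim.eventually_lt_const (u := min 1 (κ₁ * (κ / 4))) (by positivity)
    obtain ⟨δ₁, h1, h2⟩ := Metric.eventually_nhds_iff.1 this
    exact ⟨δ₁, h1, fun a ha => h2 (by simpa [Real.dist_eq] using ha)⟩
  -- The modulus is taken at level `κ₁ ^ 2` because the bound involves the square root of the `H`
  -- norm.
  obtain ⟨δ₂, hδ₂, hw₂⟩ := Metric.uniformContinuousOn_iff.1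
    ((isCompact_Icc (a := (0 : ℝ)) (b := T)).uniformContinuousOn_of_continuous hw.continuousOn)
    (κ₁ ^ 2) (by positivity)
  refine ⟨min (min (δ₁ / 2) (δ₂ / 2)) (T - t), by
    simp only [gt_iff_lt, lt_min_iff]
    refine ⟨⟨by positivity, by positivity⟩, by linarith⟩, by
    linarith [min_le_right (min (δ₁ / 2) (δ₂ / 2)) (T - t)], ?_⟩
  intro θ hθ σ hσ
  simp only [mem_Icc, le_min_iff] at hθ hσ
  have hab : |θ - σ| < δ₁ := by
    rw [abs_lt]
    constructor <;> linarith [hθ.2.1.1, hσ.2.1.1]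
  have hDab := hD₁ _ hab
  have hint : ∫ s, ‖W (s + θ) - W (s + σ)‖ ^ 2 = D (θ - σ) := by
    rw [hD]
    simp only
    rw [← integral_add_right_eq_self (fun s => ‖W (s + (θ - σ)) - W s‖ ^ 2) σ]
    refine integral_congr_ae (Eventually.of_forall fun s => ?_)
    simp only
    rw [show s + σ + (θ - σ) = s + θ by ring]
  have hmem : MemLp (fun s => W (s + θ) - W (s + σ)) 2 volume :=
    (hW.comp_measurePreserving (measurePreserving_add_right volume θ)).sub
      (hW.comp_measurePreserving (measurePreserving_add_right volume σ))
  have hβθ : MemLp (fun s => β (s + θ)) 2 volume :=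
    hβ.comp_measurePreserving (measurePreserving_add_right volume θ)
  have hβint : ∫ s, β (s + θ) ^ 2 = N := integral_add_right_eq_self (fun s => β s ^ 2) θ
  have i1 : Integrable (fun s => β (s + θ) ^ 2) := hβθ.integrable_sq
  have i2 : Integrable (fun s => ‖W (s + θ) - W (s + σ)‖ ^ 2) :=
    hmem.integrable_norm_pow two_ne_zero
  set b : ℝ → ℝ := fun s => (κ₁ * β (s + θ) ^ 2 + κ₁⁻¹ * ‖W (s + θ) - W (s + σ)‖ ^ 2) +
    κ₁ * (β (s + θ) ^ 2 + ‖W (s + θ) - W (s + σ)‖ ^ 2) with hb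
  have hbint : Integrable b := ((i1.const_mul _).add (i2.const_mul _)).add ((i1.add i2).const_mul _)
  have hb0 : ∀ s, 0 ≤ b s := fun s => by positivity
  have hbval : ∫ s, b s ≤ κ := by
    have : ∫ s, b s = (κ₁ * N + κ₁⁻¹ * D (θ - σ)) + κ₁ * (N + D (θ - σ)) := by
      have e : b = fun s => 2 * κ₁ * β (s + θ) ^ 2 +
          (κ₁⁻¹ + κ₁) * ‖W (s + θ) - W (s + σ)‖ ^ 2 := by
        ext s
        rw [hb]
        ring
      have j1 : Integrable (fun s => 2 * κ₁ * β (s + θ) ^ 2) := i1.const_mul _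
      have j2 : Integrable (fun s => (κ₁⁻¹ + κ₁) * ‖W (s + θ) - W (s + σ)‖ ^ 2) := i2.const_mul _
      rw [e, integral_add j1 j2, integral_const_mul, integral_const_mul, hβint, hint]
      ring
    rw [this]
    have h1 : D (θ - σ) < 1 := hDab.trans_le (min_le_left _ _)
    have h2 : κ₁⁻¹ * D (θ - σ) ≤ κ / 4 := by
      rw [inv_mul_le_iff₀ hκ₁0]
      exact (hDab.trans_le (min_le_right _ _)).le
    nlinarith
  have hae : ∀ᵐ s, s ∈ Ioc 0 t →
      ‖G (s + θ) (W (s + θ) - W (s + σ))‖ₑ ≤ ENNReal.ofReal (b s) := by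
    have q1 := (measurePreserving_add_right volume θ).quasiMeasurePreserving.ae hGβ
    have q2 := (measurePreserving_add_right volume θ).quasiMeasurePreserving.ae hWw
    have q3 := (measurePreserving_add_right volume σ).quasiMeasurePreserving.ae hWw
    filter_upwards [q1, q2, q3] with s h1 h2 h3 hs
    have hsθ : s + θ ∈ Ioc 0 T := ⟨by linarith [hs.1, hθ.1], by linarith [hs.2, hθ.2.2]⟩
    have hsσ : s + σ ∈ Ioc 0 T := ⟨by linarith [hs.1, hσ.1], by linarith [hs.2, hσ.2.2]⟩
    rw [Real.enorm_eq_ofReal_abs]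
    refine ENNReal.ofReal_le_ofReal ((h1 _).trans ?_)
    have hj : √‖j (W (s + θ) - W (s + σ))‖ ≤ κ₁ := by
      rw [Real.sqrt_le_left hκ₁0.le, map_sub, h2 hsθ, h3 hsσ, ← dist_eq_norm]
      refine (hw₂ _ (Ioc_subset_Icc_self hsθ) _ (Ioc_subset_Icc_self hsσ) ?_).le
      rw [Real.dist_eq, add_sub_add_left_eq_sub, abs_lt]
      constructor <;> linarith [hθ.2.1.2, hσ.2.1.2]
    refine add_le_add ?_ (by gcongr)
    set x := ‖W (s + θ) - W (s + σ)‖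
    have hy : κ₁ * β (s + θ) ^ 2 + κ₁⁻¹ * x ^ 2 - β (s + θ) * x =
        κ₁⁻¹ * ((κ₁ * β (s + θ) - x / 2) ^ 2 + 3 / 4 * x ^ 2) := by
      field_simp
      ring
    have : 0 ≤ κ₁⁻¹ * ((κ₁ * β (s + θ) - x / 2) ^ 2 + 3 / 4 * x ^ 2) := by positivity
    linarith
  calc ∫⁻ s in Ioc 0 t, ‖G (s + θ) (W (s + θ) - W (s + σ))‖ₑ
      ≤ ∫⁻ s in Ioc 0 t, ENNReal.ofReal (b s) :=
        lintegral_mono_ae ((ae_restrict_iff' measurableSet_Ioc).2 hae)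
    _ ≤ ∫⁻ s, ENNReal.ofReal (b s) := setLIntegral_le_lintegral _ _
    _ = ENNReal.ofReal (∫ s, b s) :=
        (ofReal_integral_eq_lintegral_ofReal hbint (Eventually.of_forall hb0)).symm
    _ ≤ ENNReal.ofReal κ := ENNReal.ofReal_le_ofReal hbval

/-- The energy identity, for data defined on the whole line. -/
lemma energy_identity_of_continuous {T : ℝ} (hT : 0 < T) {w : ℝ → H} (hw : Continuous w)
    {j : V →L[ℝ] H} {W : ℝ → V} {G : ℝ → StrongDual ℝ V} {β : ℝ → ℝ}
    (hWm : StronglyMeasurable W) (hGm : StronglyMeasurable G)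
    (hW : MemLp W 2 volume) (hβ : MemLp β 2 volume)
    (hGβ : ∀ᵐ s, ∀ φ, |G s φ| ≤ β s * ‖φ‖ + √‖j φ‖ * (β s ^ 2 + ‖φ‖ ^ 2))
    (hWw : ∀ᵐ s, s ∈ Ioc 0 T → j (W s) = w s) (hW0 : ∀ s ∉ Ioc 0 T, W s = 0)
    (heq : ∀ φ, ∀ t ∈ Icc 0 T,
      inner ℝ (w t) (j φ) - inner ℝ (w 0) (j φ) + ∫ s in (0 : ℝ)..t, G s φ = 0)
    {t : ℝ} (ht : t ∈ Icc 0 T) :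
    ‖w t‖ ^ 2 - ‖w 0‖ ^ 2 + 2 * ∫ s in (0 : ℝ)..t, G s (W s) = 0 := by
  obtain ⟨M, hM⟩ := (isCompact_Icc (a := (0 : ℝ)) (b := T)).exists_bound_of_continuousOn
    hw.continuousOn
  have hM0 : 0 ≤ M := (norm_nonneg _).trans (hM 0 ⟨le_rfl, hT.le⟩)
  have hg : Integrable (fun s => G s (W s)) := by
    refine integrable_pairing_of_bound hW hGm.aestronglyMeasurable hβ (M := M) ?_ hGβ
    filter_upwards [hWw] with s hs
    by_cases h : s ∈ Ioc 0 T
    · rw [hs h]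
      exact hM s (Ioc_subset_Icc_self h)
    · simpa [hW0 s h] using hM0
  have hG1 : ∀ φ, IntegrableOn (fun s => G s φ) (Ioc 0 T) := by
    intro φ
    refine integrable_pairing_of_bound (j := j) (W := fun _ => φ) (M := ‖j φ‖)
      (memLp_const φ) hGm.aestronglyMeasurable (hβ.restrict _) (by simp) (ae_restrict_of_ae hGβ)
  set Φ : ℝ → ℝ := fun x => ∫ s in (0 : ℝ)..x, G s (W s) with hΦ
  have hΦc : Continuous Φ := intervalIntegral.continuous_primitive
    (fun a b => hg.intervalIntegrable) 0
  set ψ : ℝ → ℝ := fun x => ‖w x‖ ^ 2 + 2 * Φ x with hψ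
  have hψc : Continuous ψ := by fun_prop
  -- Forward translates need room to the right of `t`; the endpoint `T` follows by continuity of
  -- `ψ`.
  suffices hsuff : ∀ t ∈ Ico 0 T, ψ t = ψ 0 by
    have hcl : t ∈ closure (Ico 0 T) := by rwa [closure_Ico hT.ne]
    have hcl2 := closure_minimal (s := Ico 0 T) (t := {x | ψ x = ψ 0}) hsuff
      (isClosed_eq hψc continuous_const)
    have := hcl2 hcl
    simp only [mem_ofPred_eq, hψ, hΦ, intervalIntegral.integral_same] at this
    linarith
  clear ht t
  intro t ht
  by_contra hne
  -- The averages will be bounded by `2 * κ`, while their limit has absolute value `4 * κ`.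
  set κ : ℝ := |ψ t - ψ 0| / 4 with hκ
  have hκ0 : 0 < κ := by
    have : 0 < |ψ t - ψ 0| := abs_pos.2 (sub_ne_zero.2 hne)
    positivity
  obtain ⟨δ, hδ, htδ, hest⟩ := lintegral_translate_le hw hW hβ hGβ hWw ht.2 hκ0
  have hkey : ∀ h ∈ Ioc 0 δ, |h⁻¹ * ∫ s in (0 : ℝ)..t, (ψ (s + h) - ψ s)| ≤ 2 * κ := by
    intro h hh
    have hpt : ∀ᵐ s, s ∈ Ioc 0 t → ‖ψ (s + h) - ψ s‖ₑ ≤ ∫⁻ θ in Ioc 0 h,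
        (‖G (s + θ) (W (s + θ) - W (s + 0))‖ₑ + ‖G (s + θ) (W (s + θ) - W (s + h))‖ₑ) := by
      have q2 := (measurePreserving_add_right volume h).quasiMeasurePreserving.ae hWw
      filter_upwards [hWw, q2] with s h1 h2 hs
      have hs1 : s ∈ Ioc 0 T := ⟨hs.1, hs.2.trans ht.2.le⟩
      have hs2 : s + h ∈ Ioc 0 T := ⟨by linarith [hs.1, hh.1], by linarith [hs.2, hh.2]⟩
      have hss : s ≤ s + h := by linarith [hh.1]
      have hI : ∀ φ, ∀ x ∈ Icc 0 T, IntervalIntegrable (fun r => G r φ) volume 0 x := by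
        intro φ x hx
        rw [intervalIntegrable_iff_integrableOn_Ioc_of_le hx.1]
        exact (hG1 φ).mono_set (Ioc_subset_Ioc_right hx.2)
      have hI2 : ∀ φ, IntervalIntegrable (fun r => G r φ) volume s (s + h) := fun φ =>
        (hI φ s (Ioc_subset_Icc_self hs1)).symm.trans (hI φ _ (Ioc_subset_Icc_self hs2))
      have hincr : ∀ φ, inner ℝ (w (s + h) - w s) (j φ) = -∫ r in s..(s + h), G r φ := by
        intro φ
        have e1 := heq φ _ (Ioc_subset_Icc_self hs1)
        have e2 := heq φ _ (Ioc_subset_Icc_self hs2)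
        have e3 := intervalIntegral.integral_interval_sub_left
          (hI φ _ (Ioc_subset_Icc_self hs2)) (hI φ _ (Ioc_subset_Icc_self hs1))
        rw [inner_sub_left]
        linarith
      -- The symmetric factorization tests the equation with `W s + W (s + h)`, a field frozen in
      -- the integration variable, for which the weak equation is available.
      have hsq : ‖w (s + h)‖ ^ 2 - ‖w s‖ ^ 2 = inner ℝ (w (s + h) - w s) (j (W s + W (s + h))) := by
        rw [map_add, h1 hs1, h2 hs2, inner_sub_left, inner_add_right, inner_add_right,
          real_inner_self_eq_norm_sq, real_inner_self_eq_norm_sq, real_inner_comm (w s)]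
        ring
      have hΦs : Φ (s + h) - Φ s = ∫ r in s..(s + h), G r (W r) :=
        intervalIntegral.integral_interval_sub_left hg.intervalIntegrable hg.intervalIntegrable
      have hψs : ψ (s + h) - ψ s =
          ∫ r in s..(s + h), (2 * G r (W r) - G r (W s + W (s + h))) := by
        rw [intervalIntegral.integral_sub (hg.intervalIntegrable.const_mul 2) (hI2 _),
          intervalIntegral.integral_const_mul, ← hΦs]
        have := hincr (W s + W (s + h))
        simp only [hψ]
        linarith
      rw [hψs, intervalIntegral.integral_of_le hss]
      refine (enorm_integral_le_lintegral_enorm _).trans ?_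
      have htr : ∫⁻ θ in Ioc 0 h,
          (‖G (s + θ) (W (s + θ) - W (s + 0))‖ₑ + ‖G (s + θ) (W (s + θ) - W (s + h))‖ₑ) =
          ∫⁻ r in Ioc s (s + h), (‖G r (W r - W s)‖ₑ + ‖G r (W r - W (s + h))‖ₑ) := by
        rw [← lintegral_indicator measurableSet_Ioc, ← lintegral_indicator measurableSet_Ioc,
          ← lintegral_add_left_eq_self ((Ioc s (s + h)).indicator _) s]
        refine lintegral_congr fun θ => ?_
        simp only [indicator, mem_Ioc, lt_add_iff_pos_right, add_le_add_iff_left, add_zero]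
      rw [htr]
      refine lintegral_mono fun r => ?_
      have : 2 * G r (W r) - G r (W s + W (s + h)) =
          G r (W r - W s) + G r (W r - W (s + h)) := by
        simp only [map_sub, map_add]
        ring
      simp only [this]
      exact enorm_add_le _ _
    have hmeas : ∀ c : ℝ, Measurable fun z : ℝ × ℝ =>
        ‖G (z.1 + z.2) (W (z.1 + z.2) - W (z.1 + c))‖ₑ := by
      intro c
      have m1 : StronglyMeasurable fun z : ℝ × ℝ => G (z.1 + z.2) :=
        hGm.comp_measurable (by fun_prop)
      have m2 : StronglyMeasurable fun z : ℝ × ℝ => W (z.1 + z.2) - W (z.1 + c) :=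
        (hWm.comp_measurable (by fun_prop)).sub (hWm.comp_measurable (by fun_prop))
      exact ((ContinuousLinearMap.apply ℝ ℝ (E := V)).flip.continuous₂.comp_stronglyMeasurable
        (m1.prodMk m2)).enorm
    have hle : ‖∫ s in (0 : ℝ)..t, (ψ (s + h) - ψ s)‖ₑ ≤ ENNReal.ofReal (2 * κ * h) := by
      rw [intervalIntegral.integral_of_le ht.1]
      calc ‖∫ s in Ioc 0 t, (ψ (s + h) - ψ s)‖ₑ
          ≤ ∫⁻ s in Ioc 0 t, ‖ψ (s + h) - ψ s‖ₑ := enorm_integral_le_lintegral_enorm _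
        _ ≤ ∫⁻ s in Ioc 0 t, ∫⁻ θ in Ioc 0 h,
              (‖G (s + θ) (W (s + θ) - W (s + 0))‖ₑ + ‖G (s + θ) (W (s + θ) - W (s + h))‖ₑ) :=
            lintegral_mono_ae ((ae_restrict_iff' measurableSet_Ioc).2 hpt)
        _ = ∫⁻ θ in Ioc 0 h, ∫⁻ s in Ioc 0 t,
              (‖G (s + θ) (W (s + θ) - W (s + 0))‖ₑ + ‖G (s + θ) (W (s + θ) - W (s + h))‖ₑ) :=
            lintegral_lintegral_swap ((hmeas 0).add (hmeas h)).aemeasurable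
        _ ≤ ∫⁻ θ in Ioc 0 h, ENNReal.ofReal (2 * κ) := by
            refine setLIntegral_mono measurable_const fun θ hθ => ?_
            have hm : Measurable fun s => ‖G (s + θ) (W (s + θ) - W (s + 0))‖ₑ :=
              (hmeas 0).comp (measurable_id.prodMk measurable_const)
            rw [lintegral_add_left hm]
            have hθ' : θ ∈ Icc 0 δ := ⟨hθ.1.le, hθ.2.trans hh.2⟩
            rw [two_mul, ENNReal.ofReal_add hκ0.le hκ0.le]
            exact add_le_add (hest θ hθ' 0 ⟨le_rfl, hδ.le⟩) (hest θ hθ' h ⟨hh.1.le, hh.2⟩)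
        _ = ENNReal.ofReal (2 * κ * h) := by
            rw [setLIntegral_const, Real.volume_Ioc, sub_zero,
              ← ENNReal.ofReal_mul (by positivity)]
    rw [Real.enorm_eq_ofReal_abs, ENNReal.ofReal_le_ofReal_iff
      (mul_nonneg (by positivity) hh.1.le)] at hle
    rw [abs_mul, abs_of_pos (inv_pos.2 hh.1), inv_mul_le_iff₀ hh.1]
    linarith
  have hlim := (tendsto_average_sub hψc t).abs
  have hfin : |ψ t - ψ 0| ≤ 2 * κ :=
    le_of_tendsto hlim (by
      filter_upwards [Ioc_mem_nhdsGT hδ] with h hh using hkey h hh)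
  have : |ψ t - ψ 0| = 4 * κ := by
    rw [hκ]
    ring
  linarith

/-- The energy identity for `w ∈ C([0,T]; H) ∩ L²(0,T; V)` with `w' = -G` in the dual of `V`, where
`G` is bounded by `|⟨G, φ⟩| ≤ β ‖φ‖ + ‖φ‖_H^{1/2} (β² + ‖φ‖²)` for some `β ∈ L²(0,T)`. -/
theorem energy_identity {T : ℝ} (hT : 0 < T) {w : ℝ → H} (hw : ContinuousOn w (Icc 0 T))
    {j : V →L[ℝ] H} {W : ℝ → V} {G : ℝ → StrongDual ℝ V} {β : ℝ → ℝ}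
    (hW : MemLp W 2 (volume.restrict (Ioc 0 T)))
    (hG : AEStronglyMeasurable G (volume.restrict (Ioc 0 T)))
    (hβ : MemLp β 2 (volume.restrict (Ioc 0 T)))
    (hGβ : ∀ᵐ s ∂(volume.restrict (Ioc 0 T)), ∀ φ,
      |G s φ| ≤ β s * ‖φ‖ + √‖j φ‖ * (β s ^ 2 + ‖φ‖ ^ 2))
    (hWw : ∀ᵐ s ∂(volume.restrict (Ioc 0 T)), j (W s) = w s)
    (heq : ∀ φ, ∀ t ∈ Icc 0 T,
      inner ℝ (w t) (j φ) - inner ℝ (w 0) (j φ) + ∫ s in (0 : ℝ)..t, G s φ = 0)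
    {t : ℝ} (ht : t ∈ Icc 0 T) :
    ‖w t‖ ^ 2 - ‖w 0‖ ^ 2 + 2 * ∫ s in (0 : ℝ)..t, G s (W s) = 0 := by
  -- The curve is extended by its endpoint values and the other data by zero, so translates make
  -- sense on the whole line. Strongly measurable representatives of `W` and `G` justify Tonelli in
  -- the two time variables.
  set w' : ℝ → H := IccExtend hT.le ((Icc 0 T).domRestrict w) with hw'
  have hw'c : Continuous w' := hw.domRestrict.Icc_extend'
  have hw'eq : ∀ s ∈ Icc 0 T, w' s = w s := fun s hs => IccExtend_of_mem _ _ hs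
  set W' : ℝ → V := (Ioc 0 T).indicator (hW.1.mk W) with hW'
  set G' : ℝ → StrongDual ℝ V := (Ioc 0 T).indicator (hG.mk G) with hG'
  have hW'W : ∀ᵐ s, s ∈ Ioc 0 T → W' s = W s := by
    filter_upwards [(ae_restrict_iff' measurableSet_Ioc).1 hW.1.ae_eq_mk] with s hs h
    rw [hW', indicator_of_mem h, hs h]
  have hG'G : ∀ᵐ s, s ∈ Ioc 0 T → G' s = G s := by
    filter_upwards [(ae_restrict_iff' measurableSet_Ioc).1 hG.ae_eq_mk] with s hs h
    rw [hG', indicator_of_mem h, hs h]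
  have hIoc : ∀ t ∈ Icc 0 T, ∀ s ∈ uIoc 0 t, s ∈ Ioc 0 T := by
    intro t ht s hs
    rw [uIoc_of_le ht.1] at hs
    exact ⟨hs.1, hs.2.trans ht.2⟩
  have key := energy_identity_of_continuous hT hw'c (j := j) (W := W') (G := G')
    (β := (Ioc 0 T).indicator β)
    (hW.1.stronglyMeasurable_mk.indicator measurableSet_Ioc)
    (hG.stronglyMeasurable_mk.indicator measurableSet_Ioc)
    ((memLp_indicator_iff_restrict measurableSet_Ioc).2 ((memLp_congr_ae hW.1.ae_eq_mk).1 hW))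
    ((memLp_indicator_iff_restrict measurableSet_Ioc).2 hβ) ?_ ?_
    (fun s hs => indicator_of_notMem hs _) ?_ ht
  · rw [hw'eq t ht, hw'eq 0 ⟨le_rfl, hT.le⟩] at key
    refine Eq.trans ?_ key
    congr 2
    refine intervalIntegral.integral_congr_ae ?_
    filter_upwards [hW'W, hG'G] with s h1 h2 hs
    rw [h1 (hIoc t ht s hs), h2 (hIoc t ht s hs)]
  · filter_upwards [hG'G, (ae_restrict_iff' measurableSet_Ioc).1 hGβ] with s h1 h2 φ
    by_cases h : s ∈ Ioc 0 T
    · rw [h1 h, indicator_of_mem h]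
      exact h2 h φ
    · rw [hG', indicator_of_notMem h, indicator_of_notMem h]
      simp only [zero_apply, abs_zero]
      positivity
  · filter_upwards [hW'W, (ae_restrict_iff' measurableSet_Ioc).1 hWw] with s h1 h2 h
    rw [h1 h, h2 h, hw'eq s (Ioc_subset_Icc_self h)]
  · intro φ r hr
    rw [hw'eq r hr, hw'eq 0 ⟨le_rfl, hT.le⟩]
    refine Eq.trans ?_ (heq φ r hr)
    congr 1
    refine intervalIntegral.integral_congr_ae ?_
    filter_upwards [hG'G] with s h1 hs
    rw [h1 (hIoc r hr s hs)]

end EnergyIdentity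

/-! ### Ladyzhenskaya's inequality and skew-symmetry for classical fields -/

section TestFields

lemma continuous_classicalGrad {φ : Plane → Plane} (hφ : ContDiff ℝ 1 φ) :
    Continuous (classicalGrad φ) := by
  have h := hφ.continuous_fderiv one_ne_zero
  refine (PiLp.continuous_toLp 2 _).comp (continuous_pi fun ij => ?_)
  exact (EuclideanSpace.proj (𝕜 := ℝ) ij.2).continuous.comp (h.clm_apply continuous_const)

lemma support_classicalGrad_subset (φ : Plane → Plane) :
    Function.support (classicalGrad φ) ⊆ tsupport φ := by
  refine fun x hx => support_fderiv_subset ℝ (f := φ) fun h0 => hx ?_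
  ext ij
  simp [classicalGrad, h0]

/-- Here `‖h‖` is the sup norm, as `h` lives in the product space where the Sobolev inequality is
applied; `√2` comes from (a + b)² ≤ 2(a² + b²). -/
lemma norm_fderiv_apply_le (φ : Plane → Plane) (x : Plane) (h : Fin 2 → ℝ) :
    ‖fderiv ℝ φ x (WithLp.toLp 2 h)‖ ≤ √2 * ‖h‖ * ‖classicalGrad φ x‖ := by
  set a : Fin 2 → Plane := fun i => fderiv ℝ φ x (EuclideanSpace.single i 1) with ha
  have h1 : fderiv ℝ φ x (WithLp.toLp 2 h) = h 0 • a 0 + h 1 • a 1 := by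
    have : (WithLp.toLp 2 h : Plane) =
        h 0 • EuclideanSpace.single 0 1 + h 1 • EuclideanSpace.single 1 1 := by
      ext i
      fin_cases i <;> simp
    rw [this, map_add, map_smul, map_smul]
  have h2 : ‖classicalGrad φ x‖ ^ 2 = ‖a 0‖ ^ 2 + ‖a 1‖ ^ 2 := by
    rw [EuclideanSpace.norm_sq_eq, EuclideanSpace.norm_sq_eq, EuclideanSpace.norm_sq_eq,
      Fintype.sum_prod_type]
    simp [classicalGrad, ha]
  have h3 : ‖h 0‖ ≤ ‖h‖ := norm_le_pi_norm h 0
  have h4 : ‖h 1‖ ≤ ‖h‖ := norm_le_pi_norm h 1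
  have h5 : ‖fderiv ℝ φ x (WithLp.toLp 2 h)‖ ≤ ‖h‖ * (‖a 0‖ + ‖a 1‖) := by
    rw [h1]
    refine (norm_add_le _ _).trans ?_
    rw [norm_smul, norm_smul, mul_add]
    gcongr
  have h6 : ‖a 0‖ + ‖a 1‖ ≤ √2 * ‖classicalGrad φ x‖ := by
    refine le_of_sq_le_sq ?_ (by positivity)
    rw [mul_pow, Real.sq_sqrt (by norm_num), h2]
    nlinarith [sq_nonneg (‖a 0‖ - ‖a 1‖)]
  calc _ ≤ ‖h‖ * (‖a 0‖ + ‖a 1‖) := h5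
    _ ≤ ‖h‖ * (√2 * ‖classicalGrad φ x‖) := by gcongr
    _ = _ := by ring

/-- Ladyzhenskaya's inequality for smooth compactly supported fields on the plane. -/
theorem lintegral_pow_four_le {φ : Plane → Plane} (hφ : ContDiff ℝ 1 φ)
    (hc : HasCompactSupport φ) :
    ∫⁻ x, ‖φ x‖ₑ ^ 4 ≤ 8 * (∫⁻ x, ‖φ x‖ₑ ^ 2) * ∫⁻ x, ‖classicalGrad φ x‖ₑ ^ 2 := by
  set e : (Fin 2 → ℝ) ≃L[ℝ] Plane := (EuclideanSpace.equiv (Fin 2) ℝ).symm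
  have he : ∀ y, e y = WithLp.toLp 2 y := fun y => rfl
  have hmp : MeasurePreserving (fun y : Fin 2 → ℝ => e y) := PiLp.volume_preserving_toLp (Fin 2)
  -- Apply the Gagliardo–Nirenberg inequality ‖v‖₂ ≤ ‖∇v‖₁ to `v = |φ|²`, then Cauchy–Schwarz to
  -- |∇v| ≤ 2√2 |φ| |∇φ|; the final constant is (2√2)² = 8.
  set v : (Fin 2 → ℝ) → ℝ := fun y => ‖φ (e y)‖ ^ 2 with hv
  have hφe : ContDiff ℝ 1 (fun y => φ (e y)) := hφ.comp e.contDiff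
  have hvd : ContDiff ℝ 1 v := hφe.norm_sq ℝ
  have hvc : HasCompactSupport v := by
    have h1 : HasCompactSupport (fun y => φ (e y)) := hc.comp_homeomorph e.toHomeomorph
    exact h1.comp_left (g := fun z : Plane => ‖z‖ ^ 2) (by simp)
  have hfd : ∀ y, ‖fderiv ℝ v y‖ ≤ 2 * √2 * (‖φ (e y)‖ * ‖classicalGrad φ (e y)‖) := by
    intro y
    refine ContinuousLinearMap.opNorm_le_bound _ (by positivity) fun h => ?_
    have hd : HasFDerivAt (fun y => φ (e y))
        ((fderiv ℝ φ (e y)).comp (e : (Fin 2 → ℝ) →L[ℝ] Plane)) y :=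
      ((hφ.differentiable one_ne_zero (e y)).hasFDerivAt).comp y e.hasFDerivAt
    have hd2 := hd.norm_sq
    rw [hd2.fderiv]
    have : ‖(2 • (innerSL ℝ (φ (e y))).comp
        ((fderiv ℝ φ (e y)).comp (e : (Fin 2 → ℝ) →L[ℝ] Plane))) h‖ =
        2 * ‖inner ℝ (φ (e y)) (fderiv ℝ φ (e y) (WithLp.toLp 2 h))‖ := by
      simp [he]
    rw [this]
    calc 2 * ‖inner ℝ (φ (e y)) (fderiv ℝ φ (e y) (WithLp.toLp 2 h))‖
        ≤ 2 * (‖φ (e y)‖ * (√2 * ‖h‖ * ‖classicalGrad φ (e y)‖)) := by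
          gcongr
          exact (norm_inner_le_norm _ _).trans (by gcongr; exact norm_fderiv_apply_le _ _ _)
      _ = _ := by ring
  have hfd' : ∀ y, ‖fderiv ℝ v y‖ₑ ≤
      ENNReal.ofReal (2 * √2) * (‖φ (e y)‖ₑ * ‖classicalGrad φ (e y)‖ₑ) := by
    intro y
    rw [← ofReal_norm, ← ofReal_norm, ← ofReal_norm,
      ← ENNReal.ofReal_mul (by positivity), ← ENNReal.ofReal_mul (by positivity)]
    exact ENNReal.ofReal_le_ofReal (hfd y)
  have hgns := lintegral_pow_le_pow_lintegral_fderiv_aux (p := 2)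
    (by simpa using Real.HolderConjugate.two_two) hvd hvc
  have hφm : Measurable fun x => ‖φ x‖ₑ := hφ.continuous.measurable.enorm
  have hgm : Measurable fun x => ‖classicalGrad φ x‖ₑ :=
    (continuous_classicalGrad hφ).measurable.enorm
  have hL : ∫⁻ y, ‖v y‖ₑ ^ (2 : ℝ) = ∫⁻ x, ‖φ x‖ₑ ^ 4 := by
    rw [← hmp.lintegral_comp (hφm.pow_const 4)]
    refine lintegral_congr fun y => ?_
    rw [hv]
    simp only [enorm_pow, enorm_norm]
    rw [← ENNReal.rpow_natCast, ← ENNReal.rpow_natCast, ← ENNReal.rpow_mul]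
    norm_num
  have hCS := ENNReal.lintegral_mul_le_Lp_mul_Lq volume Real.HolderConjugate.two_two
    hφm.aemeasurable hgm.aemeasurable
  calc ∫⁻ x, ‖φ x‖ₑ ^ 4 = ∫⁻ y, ‖v y‖ₑ ^ (2 : ℝ) := hL.symm
    _ ≤ (∫⁻ y, ‖fderiv ℝ v y‖ₑ) ^ (2 : ℝ) := hgns
    _ ≤ (ENNReal.ofReal (2 * √2) * ∫⁻ x, ‖φ x‖ₑ * ‖classicalGrad φ x‖ₑ) ^ (2 : ℝ) := by
        gcongr
        have hm : Measurable fun x => ‖φ x‖ₑ * ‖classicalGrad φ x‖ₑ := hφm.mul hgm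
        rw [← hmp.lintegral_comp hm, ← lintegral_const_mul' _ _ ENNReal.ofReal_ne_top]
        exact lintegral_mono hfd'
    _ ≤ (ENNReal.ofReal (2 * √2) * ((∫⁻ x, ‖φ x‖ₑ ^ (2 : ℝ)) ^ (1 / (2 : ℝ)) *
          (∫⁻ x, ‖classicalGrad φ x‖ₑ ^ (2 : ℝ)) ^ (1 / (2 : ℝ)))) ^ (2 : ℝ) := by
        gcongr
        exact hCS
    _ = _ := by
        rw [ENNReal.mul_rpow_of_nonneg _ _ (by norm_num),
          ENNReal.mul_rpow_of_nonneg _ _ (by norm_num), ← ENNReal.rpow_mul, ← ENNReal.rpow_mul,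
          ENNReal.ofReal_rpow_of_nonneg (by positivity) (by norm_num)]
        norm_num [mul_pow]
        ring

lemma integral_fderiv_eq_zero {F : Plane → ℝ} (hF : ContDiff ℝ 1 F) (hc : HasCompactSupport F)
    (v : Plane) : ∫ x, fderiv ℝ F x v = 0 := by
  have hi : Integrable (fun x => fderiv ℝ F x v) :=
    ((hF.continuous_fderiv one_ne_zero).clm_apply continuous_const).integrable_of_hasCompactSupport
      ((hc.fderiv ℝ).comp_left (g := fun L : Plane →L[ℝ] ℝ => L v) (by simp))
  have := integral_mul_fderiv_eq_neg_fderiv_mul_of_integrable (μ := (volume : Measure Plane))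
    (f := fun _ : Plane => (1 : ℝ)) (g := F) (v := v) (by simp) (by simpa using hi)
    (by simpa using hF.continuous.integrable_of_hasCompactSupport hc) (by simp)
    (fun x _ => hF.differentiable one_ne_zero x)
  simpa using this

/-- The integrand of the convective form for classical fields. -/
noncomputable def classicalConv (φ ψ χ : Plane → Plane) (x : Plane) : ℝ :=
  (∑ i : Fin 2, ∑ j : Fin 2, φ x i * classicalGrad ψ x (i, j) * χ x j) +
    (1 / 2) * (∑ i : Fin 2, classicalGrad φ x (i, i)) * ∑ j : Fin 2, ψ x j * χ x j

lemma integrable_classicalConv {φ ψ χ : Plane → Plane} (hφ : ContDiff ℝ 1 φ) (hψ : ContDiff ℝ 1 ψ)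
    (hχ : ContDiff ℝ 1 χ) (hc : HasCompactSupport χ) : Integrable (classicalConv φ ψ χ) := by
  have h1 := hφ.continuous
  have h2 := hψ.continuous
  have h3 := hχ.continuous
  have h4 := continuous_classicalGrad hφ
  have h5 := continuous_classicalGrad hψ
  refine Continuous.integrable_of_hasCompactSupport ?_ (hc.mono fun x hx => ?_)
  · unfold classicalConv
    fun_prop
  · contrapose! hx
    simp only [Function.mem_support, ne_eq, not_not] at hx ⊢
    simp [classicalConv, hx]

/-- The integrands of the two forms add up to the divergence of (ψ·χ) φ, the two halves of Div φ
supplying the missing term. The integral of this divergence vanishes by compact support. -/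
lemma integral_classicalConv_add {φ ψ χ : Plane → Plane} (hφ : ContDiff ℝ 1 φ)
    (hψ : ContDiff ℝ 1 ψ) (hχ : ContDiff ℝ 1 χ) (hψc : HasCompactSupport ψ)
    (hc : HasCompactSupport χ) :
    ∫ x, classicalConv φ ψ χ x = -∫ x, classicalConv φ χ ψ x := by
  rw [eq_neg_iff_add_eq_zero, ← integral_add (integrable_classicalConv hφ hψ hχ hc)
    (integrable_classicalConv hφ hχ hψ hψc)]
  set F : Fin 2 → Plane → ℝ := fun i x => φ x i * inner ℝ (ψ x) (χ x) with hF
  have hFd : ∀ i, ContDiff ℝ 1 (F i) := fun i =>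
    ((EuclideanSpace.proj (𝕜 := ℝ) i).contDiff.comp hφ).mul (hψ.inner ℝ hχ)
  have hFc : ∀ i, HasCompactSupport (F i) := fun i => hc.mono fun x hx => by
    contrapose! hx
    simp only [Function.mem_support, ne_eq, not_not] at hx ⊢
    simp [hF, hx]
  have hpt : ∀ x, classicalConv φ ψ χ x + classicalConv φ χ ψ x =
      ∑ i, fderiv ℝ (F i) x (EuclideanSpace.single i 1) := by
    intro x
    have hd : ∀ i, fderiv ℝ (F i) x (EuclideanSpace.single i 1) =
        φ x i * (inner ℝ (ψ x) (fderiv ℝ χ x (EuclideanSpace.single i 1)) +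
          inner ℝ (fderiv ℝ ψ x (EuclideanSpace.single i 1)) (χ x)) +
        inner ℝ (ψ x) (χ x) * fderiv ℝ φ x (EuclideanSpace.single i 1) i := by
      intro i
      have dφ := (hφ.differentiable one_ne_zero x).hasFDerivAt
      have dψ := (hψ.differentiable one_ne_zero x).hasFDerivAt
      have dχ := (hχ.differentiable one_ne_zero x).hasFDerivAt
      have d1 : HasFDerivAt (fun x => φ x i)
          ((EuclideanSpace.proj (𝕜 := ℝ) i).comp (fderiv ℝ φ x)) x :=
        (EuclideanSpace.proj (𝕜 := ℝ) i).hasFDerivAt.comp x dφ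
      have d2 : HasFDerivAt (F i) _ x := d1.mul (dψ.inner ℝ dχ)
      rw [d2.fderiv]
      simp
    simp only [hd]
    simp only [classicalConv, classicalGrad, Fin.sum_univ_two, PiLp.inner_apply, RCLike.inner_apply,
      conj_trivial]
    ring
  simp_rw [hpt]
  rw [integral_finsetSum]
  · exact Finset.sum_eq_zero fun i _ => integral_fderiv_eq_zero (hFd i) (hFc i) _
  · intro i _
    exact (((hFd i).continuous_fderiv one_ne_zero).clm_apply
      continuous_const).integrable_of_hasCompactSupport
      (((hFc i).fderiv ℝ).comp_left (g := fun L : Plane →L[ℝ] ℝ => L _) (by simp))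

end TestFields

/-! ### The space H¹₀, its embedding in L⁴ and the convective form -/

section SobolevSpace

variable {O : Set Plane}

/-- The inclusion `H¹₀ ⊆ L²`, as a continuous linear map. -/
noncomputable def valL (O : Set Plane) : H10 O →L[ℝ] L2v O :=
  (WithLp.fstL 2 ℝ (L2v O) (L2g O)).comp (H10Submodule O).subtypeL

/-- The weak gradient, as a continuous linear map. -/
noncomputable def gradL (O : Set Plane) : H10 O →L[ℝ] L2g O :=
  (WithLp.sndL 2 ℝ (L2v O) (L2g O)).comp (H10Submodule O).subtypeL

@[simp] lemma valL_apply (U : H10 O) : valL O U = U.val := rfl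

@[simp] lemma gradL_apply (U : H10 O) : gradL O U = U.grad := rfl

/-- The trace of a gradient. -/
noncomputable def traceL : Grad →L[ℝ] ℝ :=
  ∑ i : Fin 2, EuclideanSpace.proj (𝕜 := ℝ) ((i, i) : Fin 2 × Fin 2)

lemma traceL_apply (A : Grad) : traceL A = ∑ i : Fin 2, A (i, i) := by
  simp [traceL]

lemma norm_traceL_le : ‖traceL‖ ≤ 2 := by
  refine ContinuousLinearMap.opNorm_le_bound _ (by norm_num) fun A => ?_
  rw [traceL_apply, Fin.sum_univ_two]
  refine (norm_add_le _ _).trans ?_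
  have h1 := PiLp.norm_apply_le A ((0, 0) : Fin 2 × Fin 2)
  have h2 := PiLp.norm_apply_le A ((1, 1) : Fin 2 × Fin 2)
  linarith

/-- The divergence, as a continuous linear map to `L²`. -/
noncomputable def divL (O : Set Plane) : H10 O →L[ℝ] L2s O :=
  (traceL.compLpL 2 (volume.restrict O)).comp (gradL O)

lemma coeFn_divL (U : H10 O) : divL O U =ᵐ[volume.restrict O] U.div := by
  filter_upwards [traceL.coeFn_compLpL U.grad] with x hx
  simp only [divL, ContinuousLinearMap.comp_apply, gradL_apply, hx, traceL_apply, H10.div]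

lemma norm_divL_apply_le (U : H10 O) : ‖divL O U‖ ≤ 2 * ‖U.grad‖ :=
  (ContinuousLinearMap.norm_compLp_le traceL U.grad).trans (by gcongr; exact norm_traceL_le)

lemma pairDiv_eq_inner (η : L2s O) (U : H10 O) : pairDiv η U = inner ℝ η (divL O U) := by
  rw [L2.inner_def, pairDiv]
  refine integral_congr_ae ?_
  filter_upwards [coeFn_divL U] with x hx
  simp [hx, mul_comm]

lemma norm_sq_eq_val_add_grad (U : H10 O) : ‖U‖ ^ 2 = ‖U.val‖ ^ 2 + ‖U.grad‖ ^ 2 := by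
  exact WithLp.prod_norm_sq_eq_of_L2 (U : WithLp 2 (L2v O × L2g O))

lemma norm_val_le (U : H10 O) : ‖U.val‖ ≤ ‖U‖ :=
  le_of_sq_le_sq (by rw [norm_sq_eq_val_add_grad]; linarith [sq_nonneg ‖U.grad‖]) (norm_nonneg _)

lemma norm_grad_le (U : H10 O) : ‖U.grad‖ ≤ ‖U‖ :=
  le_of_sq_le_sq (by rw [norm_sq_eq_val_add_grad]; linarith [sq_nonneg ‖U.val‖]) (norm_nonneg _)

/-! ### Density of the test fields -/

/-- `U` is represented by the smooth compactly supported field `φ`. -/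
structure IsTestField (U : H10 O) (φ : Plane → Plane) : Prop where
  contDiff : ContDiff ℝ 1 φ
  hasCompactSupport : HasCompactSupport φ
  tsupport_subset : tsupport φ ⊆ O
  val_ae_eq : U.val =ᵐ[volume.restrict O] φ
  grad_ae_eq : U.grad =ᵐ[volume.restrict O] classicalGrad φ

lemma classicalGrad_add {φ ψ : Plane → Plane} {x : Plane} (hφ : DifferentiableAt ℝ φ x)
    (hψ : DifferentiableAt ℝ ψ x) :
    classicalGrad (φ + ψ) x = classicalGrad φ x + classicalGrad ψ x := by
  ext ij
  simp [classicalGrad, fderiv_add hφ hψ]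

lemma classicalGrad_smul (c : ℝ) {φ : Plane → Plane} {x : Plane} (hφ : DifferentiableAt ℝ φ x) :
    classicalGrad (c • φ) x = c • classicalGrad φ x := by
  ext ij
  simp [classicalGrad, fderiv_const_smul hφ c]

/-- Test pairs already form a subspace, so density arguments can use a single classical field
instead of a linear combination. -/
lemma span_testPairs_subset : (Submodule.span ℝ (testPairs O) : Set _) ⊆ testPairs O := by
  intro z hz
  induction hz using Submodule.span_induction with
  | mem z hz => exact hz
  | zero =>
    refine ⟨0, contDiff_const, HasCompactSupport.zero, by simp, ?_, ?_⟩
    · exact Lp.coeFn_zero _ _ _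
    · filter_upwards [Lp.coeFn_zero Grad 2 (volume.restrict O)] with x hx
      have : classicalGrad 0 x = 0 := by
        ext ij
        simp [classicalGrad]
      rw [this]
      exact hx
  | add y z _ _ hy hz =>
    obtain ⟨φ, h1, h2, h3, h4, h5⟩ := hy
    obtain ⟨ψ, k1, k2, k3, k4, k5⟩ := hz
    refine ⟨φ + ψ, h1.add k1, h2.add k2, (tsupport_add φ ψ).trans (union_subset h3 k3), ?_, ?_⟩
    · exact (Lp.coeFn_add y.fst z.fst).trans (h4.add k4)
    · filter_upwards [Lp.coeFn_add y.snd z.snd, h5, k5] with x hx hx1 hx2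
      rw [classicalGrad_add (h1.differentiable (by simp) x) (k1.differentiable (by simp) x)]
      refine hx.trans ?_
      rw [Pi.add_apply, hx1, hx2]
  | smul c y _ hy =>
    obtain ⟨φ, h1, h2, h3, h4, h5⟩ := hy
    refine ⟨c • φ, h1.const_smul c, h2.smul_left (f := fun _ => c),
      (tsupport_smul_subset_right (fun _ => c) φ).trans h3, ?_, ?_⟩
    · filter_upwards [Lp.coeFn_smul c y.fst, h4] with x hx hx1
      refine hx.trans ?_
      rw [Pi.smul_apply, hx1, Pi.smul_apply]
    · filter_upwards [Lp.coeFn_smul c y.snd, h5] with x hx hx1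
      rw [classicalGrad_smul c (h1.differentiable (by simp) x)]
      refine hx.trans ?_
      rw [Pi.smul_apply, hx1]

lemma denseRange_testFields :
    DenseRange (Subtype.val : {U : H10 O // ∃ φ, IsTestField U φ} → H10 O) := by
  intro U
  have hr : range (Subtype.val : {U : H10 O // ∃ φ, IsTestField U φ} → H10 O) =
      {U : H10 O | ∃ φ, IsTestField U φ} := Subtype.range_coe
  rw [hr, closure_subtype]
  have hU : (U : WithLp 2 (L2v O × L2g O)) ∈ closure (Submodule.span ℝ (testPairs O) : Set _) := by
    rw [← Submodule.topologicalClosure_coe]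
    exact U.2
  refine closure_mono (fun z hz => ?_) hU
  obtain ⟨φ, h1, h2, h3, h4, h5⟩ := span_testPairs_subset hz
  exact ⟨⟨z, Submodule.le_topologicalClosure _ hz⟩, ⟨φ, h1.of_le (by simp), h2, h3, h4, h5⟩, rfl⟩

/-! ### Ladyzhenskaya's inequality -/

lemma eLpNorm_two_sq {α E : Type*} [MeasurableSpace α] [NormedAddCommGroup E] {μ : Measure α}
    (f : α → E) : eLpNorm f 2 μ ^ 2 = ∫⁻ x, ‖f x‖ₑ ^ 2 ∂μ := by
  have := eLpNorm_nnreal_pow_eq_lintegral (f := f) (μ := μ) (p := 2) two_ne_zero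
  simpa using this

lemma eLpNorm_four_pow {α E : Type*} [MeasurableSpace α] [NormedAddCommGroup E] {μ : Measure α}
    (f : α → E) : eLpNorm f 4 μ ^ 4 = ∫⁻ x, ‖f x‖ₑ ^ 4 ∂μ := by
  have := eLpNorm_nnreal_pow_eq_lintegral (f := f) (μ := μ) (p := 4) four_ne_zero
  simpa using this

lemma IsTestField.eLpNorm_four_le {U : H10 O} {φ : Plane → Plane} (h : IsTestField U φ) :
    eLpNorm U.val 4 (volume.restrict O) ^ 4 ≤ 8 * ‖U.val‖ₑ ^ 2 * ‖U.grad‖ₑ ^ 2 := by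
  have hsupp : ∀ f : Plane → ℝ≥0∞, (Function.support f ⊆ tsupport φ) →
      ∫⁻ x in O, f x = ∫⁻ x, f x := fun f hf =>
    setLIntegral_eq_of_support_subset (hf.trans h.tsupport_subset)
  have h1 : ∀ n : ℕ, n ≠ 0 → Function.support (fun x => ‖φ x‖ₑ ^ n) ⊆ tsupport φ := by
    intro n hn x hx
    refine subset_tsupport φ fun h0 => hx ?_
    simp [h0, hn]
  have h2 : Function.support (fun x => ‖classicalGrad φ x‖ₑ ^ 2) ⊆ tsupport φ := by
    intro x hx
    refine support_classicalGrad_subset φ fun h0 => hx ?_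
    simp [h0]
  rw [Lp.enorm_def, Lp.enorm_def, eLpNorm_congr_ae h.val_ae_eq, eLpNorm_congr_ae h.val_ae_eq,
    eLpNorm_congr_ae h.grad_ae_eq, eLpNorm_two_sq, eLpNorm_two_sq, eLpNorm_four_pow,
    hsupp _ (h1 4 four_ne_zero), hsupp _ (h1 2 two_ne_zero), hsupp _ h2]
  exact lintegral_pow_four_le h.contDiff h.hasCompactSupport

/-- Ladyzhenskaya's inequality in `H¹₀`. -/
theorem eL4norm_pow_four_le (U : H10 O) :
    eL4norm U.val ^ 4 ≤ 8 * ‖U.val‖ₑ ^ 2 * ‖U.grad‖ₑ ^ 2 := by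
  refine isClosed_property (p := fun U : H10 O =>
    eL4norm U.val ^ 4 ≤ 8 * ‖U.val‖ₑ ^ 2 * ‖U.grad‖ₑ ^ 2) denseRange_testFields ?_ ?_ U
  · refine IsSeqClosed.isClosed fun x U hx hlim => ?_
    have hv : Tendsto (fun n => (x n).val) atTop (𝓝 U.val) :=
      ((valL O).continuous.tendsto U).comp hlim
    have hg : Tendsto (fun n => (x n).grad) atTop (𝓝 U.grad) :=
      ((gradL O).continuous.tendsto U).comp hlim
    -- L² convergence does not control the L⁴ norm from above; Fatou's lemma along an almost
    -- everywhere convergent subsequence gives the lower semicontinuity needed to close the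
    -- inequality.
    obtain ⟨ns, hns, hae⟩ := (tendstoInMeasure_of_tendsto_Lp hv).exists_seq_tendsto_ae
    have hb : Tendsto (fun n => 8 * ‖(x (ns n)).val‖ₑ ^ 2 * ‖(x (ns n)).grad‖ₑ ^ 2) atTop
        (𝓝 (8 * ‖U.val‖ₑ ^ 2 * ‖U.grad‖ₑ ^ 2)) := by
      have e1 := ENNReal.Tendsto.pow (n := 2) (hv.comp hns.tendsto_atTop).enorm
      have e2 := ENNReal.Tendsto.pow (n := 2) (hg.comp hns.tendsto_atTop).enorm
      exact ENNReal.Tendsto.mul (ENNReal.Tendsto.const_mul e1 (Or.inr (by simp)))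
        (Or.inr (by simp)) e2 (Or.inr (ENNReal.mul_ne_top (by simp) (by simp)))
    have hle : eL4norm U.val ≤ (8 * ‖U.val‖ₑ ^ 2 * ‖U.grad‖ₑ ^ 2) ^ (4 : ℝ)⁻¹ := by
      refine (Lp.eLpNorm_lim_le_liminf_eLpNorm
        (fun n => Lp.aestronglyMeasurable (x (ns n)).val) _ hae).trans ?_
      rw [← (hb.ennrpow_const (4 : ℝ)⁻¹).liminf_eq]
      refine liminf_le_liminf (Eventually.of_forall fun n => ?_)
      rw [ENNReal.le_rpow_inv_iff (by norm_num)]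
      simpa [eL4norm] using hx (ns n)
    rw [ENNReal.le_rpow_inv_iff (by norm_num)] at hle
    simpa using hle
  · rintro ⟨U, φ, hφ⟩
    exact hφ.eLpNorm_four_le

lemma eL4norm_lt_top (U : H10 O) : eL4norm U.val < ⊤ := by
  have h := (eL4norm_pow_four_le U).trans_lt
    (ENNReal.mul_lt_top (ENNReal.mul_lt_top (by simp) (by simp)) (by simp))
  exact (ENNReal.pow_lt_top_iff.1 h).resolve_right (by simp)

lemma L4norm_pow_four_le (U : H10 O) : L4norm U.val ^ 4 ≤ 8 * ‖U.val‖ ^ 2 * ‖U.grad‖ ^ 2 := by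
  have h := ENNReal.toReal_mono (by finiteness) (eL4norm_pow_four_le U)
  simpa [L4norm] using h

lemma memLp_four (U : H10 O) : MemLp U.val 4 (volume.restrict O) :=
  ⟨Lp.aestronglyMeasurable _, eL4norm_lt_top U⟩

instance fact_one_le_four : Fact ((1 : ℝ≥0∞) ≤ 4) := ⟨by norm_num⟩

instance holderTriple_four_four_two : ENNReal.HolderTriple 4 4 2 where
  inv_add_inv_eq_inv := by
    rw [← ENNReal.toReal_eq_toReal_iff' (by simp) (by simp), ENNReal.toReal_add (by simp) (by simp)]
    norm_num

/-- The Sobolev embedding `H¹₀ ⊆ L⁴`. -/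
noncomputable def embL4 (O : Set Plane) : H10 O →L[ℝ] Lp Plane 4 (volume.restrict O) :=
  LinearMap.mkContinuous
    { toFun := fun U => (memLp_four U).toLp U.val
      map_add' := fun U V => by
        rw [← MemLp.toLp_add]
        exact MemLp.toLp_congr _ _ (Lp.coeFn_add U.val V.val)
      map_smul' := fun c U => by
        rw [RingHom.id_apply, ← MemLp.toLp_const_smul]
        exact MemLp.toLp_congr _ _ (Lp.coeFn_smul c U.val) } 2 fun U => by
    have h1 : ‖(memLp_four U).toLp U.val‖ = L4norm U.val := Lp.norm_toLp _ _
    change ‖(memLp_four U).toLp U.val‖ ≤ _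
    rw [h1]
    refine le_of_pow_le_pow_left₀ four_ne_zero (by positivity) ?_
    refine (L4norm_pow_four_le U).trans ?_
    have h2 := norm_val_le U
    have h3 := norm_grad_le U
    calc 8 * ‖U.val‖ ^ 2 * ‖U.grad‖ ^ 2 ≤ 8 * ‖U‖ ^ 2 * ‖U‖ ^ 2 := by gcongr
      _ ≤ (2 * ‖U‖) ^ 4 := by nlinarith [sq_nonneg (‖U‖ ^ 2)]

lemma coeFn_embL4 (U : H10 O) : embL4 O U =ᵐ[volume.restrict O] U.val :=
  MemLp.coeFn_toLp (memLp_four U)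

lemma norm_embL4 (U : H10 O) : ‖embL4 O U‖ = L4norm U.val :=
  Lp.norm_toLp _ (memLp_four U)

/-! ### The convective form -/

/-- The tensor product of two vectors of the plane. -/
noncomputable def outerL : Plane →L[ℝ] Plane →L[ℝ] Grad :=
  LinearMap.mkContinuous₂
    (LinearMap.mk₂ ℝ (fun a b : Plane => (WithLp.toLp 2 fun ij => a ij.1 * b ij.2 : Grad))
      (fun a a' b => by ext; simp [add_mul]) (fun c a b => by ext; simp [mul_assoc])
      (fun a b b' => by ext; simp [mul_add]) (fun c a b => by ext; simp [mul_left_comm])) 1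
    fun a b => by
      rw [one_mul]
      refine le_of_eq ?_
      rw [← sq_eq_sq₀ (norm_nonneg _) (by positivity), mul_pow]
      simp only [LinearMap.mk₂_apply, EuclideanSpace.norm_sq_eq, Fintype.sum_prod_type,
        Fin.sum_univ_two, norm_mul]
      ring

@[simp] lemma outerL_apply (a b : Plane) (ij : Fin 2 × Fin 2) :
    outerL a b ij = a ij.1 * b ij.2 := rfl

lemma norm_outerL_le : ‖outerL‖ ≤ 1 := LinearMap.mkContinuous₂_norm_le _ zero_le_one _

/-- The tensor product `L⁴ × L⁴ → L²`. -/
noncomputable def outerLp (O : Set Plane) :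
    Lp Plane 4 (volume.restrict O) →L[ℝ] Lp Plane 4 (volume.restrict O) →L[ℝ] L2g O :=
  outerL.holderL (volume.restrict O) 4 4 2

/-- The scalar product `L⁴ × L⁴ → L²`. -/
noncomputable def dotLp (O : Set Plane) :
    Lp Plane 4 (volume.restrict O) →L[ℝ] Lp Plane 4 (volume.restrict O) →L[ℝ] L2s O :=
  (innerSL ℝ : Plane →L[ℝ] Plane →L[ℝ] ℝ).holderL (volume.restrict O) 4 4 2

lemma norm_outerLp_apply_le (a b : Lp Plane 4 (volume.restrict O)) :
    ‖outerLp O a b‖ ≤ ‖a‖ * ‖b‖ := by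
  refine (ContinuousLinearMap.norm_holder_apply_apply_le outerL a b).trans ?_
  rw [mul_assoc]
  exact mul_le_of_le_one_left (by positivity) norm_outerL_le

lemma norm_dotLp_apply_le (a b : Lp Plane 4 (volume.restrict O)) :
    ‖dotLp O a b‖ ≤ ‖a‖ * ‖b‖ := by
  refine (ContinuousLinearMap.norm_holder_apply_apply_le
    (innerSL ℝ : Plane →L[ℝ] Plane →L[ℝ] ℝ) a b).trans ?_
  rw [mul_assoc]
  exact mul_le_of_le_one_left (by positivity) (norm_innerSL_le ℝ)

/-- The convective form with its two first arguments fixed. -/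
noncomputable def convDual (U V : H10 O) : StrongDual ℝ (H10 O) :=
  (innerSL ℝ V.grad).comp ((outerLp O (embL4 O U)).comp (embL4 O)) +
    (1 / 2 : ℝ) • (innerSL ℝ (divL O U)).comp ((dotLp O (embL4 O V)).comp (embL4 O))

lemma convDual_apply (U V W : H10 O) : convDual U V W =
    inner ℝ V.grad (outerLp O (embL4 O U) (embL4 O W)) +
      1 / 2 * inner ℝ (divL O U) (dotLp O (embL4 O V) (embL4 O W)) := rfl

/-- Joint continuity in the dual norm serves twice: it extends skew-symmetry from test fields by
density, and it makes the drift strongly measurable in time. -/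
lemma continuous_convDual :
    Continuous fun z : H10 O × H10 O => convDual z.1 z.2 := by
  have h1 : Continuous fun z : H10 O × H10 O => innerSL ℝ (gradL O z.2) := by fun_prop
  have h2 : Continuous fun z : H10 O × H10 O => innerSL ℝ (divL O z.1) := by fun_prop
  have h3 : Continuous fun z : H10 O × H10 O => outerLp O (embL4 O z.1) := by fun_prop
  have h4 : Continuous fun z : H10 O × H10 O => dotLp O (embL4 O z.2) := by fun_prop
  exact (h1.clm_comp (h3.clm_comp continuous_const)).add
    ((h2.clm_comp (h4.clm_comp continuous_const)).fun_const_smul _)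

attribute [irreducible] convDual

lemma convForm_eq (U V W : H10 O) : convForm U V W = convDual U V W := by
  rw [convDual_apply, L2.inner_def, L2.inner_def, ← integral_const_mul,
    ← integral_add (L2.integrable_inner _ _) ((L2.integrable_inner _ _).const_mul _)]
  refine integral_congr_ae ?_
  filter_upwards [coeFn_divL U, coeFn_embL4 U, coeFn_embL4 V, coeFn_embL4 W,
    ContinuousLinearMap.coeFn_holder (r := 2) outerL (embL4 O U) (embL4 O W),
    ContinuousLinearMap.coeFn_holder (r := 2) (innerSL ℝ : Plane →L[ℝ] Plane →L[ℝ] ℝ)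
      (embL4 O V) (embL4 O W)] with x h1 h2 h3 h4 h5 h6
  change _ = inner ℝ (V.grad x) (outerL.holder 2 (embL4 O U) (embL4 O W) x) + 1 / 2 *
    inner ℝ (divL O U x) ((innerSL ℝ : Plane →L[ℝ] Plane →L[ℝ] ℝ).holder 2
      (embL4 O V) (embL4 O W) x)
  have h7 : ∀ a b : Plane, (innerSL ℝ : Plane →L[ℝ] Plane →L[ℝ] ℝ) a b = inner ℝ a b :=
    fun _ _ => rfl
  rw [h1, h5, h6, h2, h3, h4, h7]
  simp only [PiLp.inner_apply, Fintype.sum_prod_type, Fin.sum_univ_two, outerL_apply,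
    RCLike.inner_apply, conj_trivial]
  ring

/-- Hölder with exponents 2, 4, 4. The factor 2 lost in bounding the trace by the Frobenius norm
cancels the ½ before the divergence. -/
lemma abs_convForm_le (U V W : H10 O) : |convForm U V W| ≤
    ‖V.grad‖ * (L4norm U.val * L4norm W.val) + ‖U.grad‖ * (L4norm V.val * L4norm W.val) := by
  rw [convForm_eq, convDual_apply]
  refine (abs_add_le _ _).trans (add_le_add ?_ ?_)
  · refine (abs_real_inner_le_norm _ _).trans ?_
    gcongr
    simpa only [norm_embL4] using norm_outerLp_apply_le (embL4 O U) (embL4 O W)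
  · rw [abs_mul]
    have h1 := abs_real_inner_le_norm (divL O U) (dotLp O (embL4 O V) (embL4 O W))
    have h2 := norm_dotLp_apply_le (embL4 O V) (embL4 O W)
    rw [norm_embL4, norm_embL4] at h2
    have h3 := norm_divL_apply_le U
    calc |(1 / 2 : ℝ)| * |inner ℝ (divL O U) (dotLp O (embL4 O V) (embL4 O W))|
        ≤ |(1 / 2 : ℝ)| * ((2 * ‖U.grad‖) * (L4norm V.val * L4norm W.val)) := by
          gcongr
          exact h1.trans (by gcongr)
      _ = _ := by
          rw [abs_of_pos (by norm_num)]
          ring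

/-- The convective form is skew-symmetric in its two last arguments. -/
theorem convForm_skew (U V W : H10 O) : convForm U V W = -convForm U W V := by
  simp only [convForm_eq]
  refine isClosed_property3 (p := fun U V W : H10 O => convDual U V W = -convDual U W V)
    denseRange_testFields ?_ ?_ U V W
  · have c1 : Continuous fun z : H10 O × H10 O × H10 O => convDual z.1 z.2.1 z.2.2 :=
      (continuous_convDual.comp (by fun_prop : Continuous fun z : H10 O × H10 O × H10 O =>
        (z.1, z.2.1))).clm_apply (by fun_prop)
    have c2 : Continuous fun z : H10 O × H10 O × H10 O => convDual z.1 z.2.2 z.2.1 :=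
      (continuous_convDual.comp (by fun_prop : Continuous fun z : H10 O × H10 O × H10 O =>
        (z.1, z.2.2))).clm_apply (by fun_prop)
    exact isClosed_eq c1 c2.neg
  · rintro ⟨U, φ, hφ⟩ ⟨V, ψ, hψ⟩ ⟨W, χ, hχ⟩
    simp only [← convForm_eq]
    have key : ∀ {V W : H10 O} {ψ χ : Plane → Plane}, IsTestField V ψ → IsTestField W χ →
        convForm U V W = ∫ x, classicalConv φ ψ χ x := by
      intro V W ψ χ hψ hχ
      rw [← setIntegral_eq_integral_of_forall_compl_eq_zero (s := O)]
      · refine integral_congr_ae ?_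
        filter_upwards [hφ.val_ae_eq, hφ.grad_ae_eq, hψ.val_ae_eq, hψ.grad_ae_eq, hχ.val_ae_eq]
          with x h1 h2 h3 h4 h5
        simp only [H10.div, classicalConv, h1, h2, h3, h4, h5]
      · intro x hx
        have : χ x = 0 := image_eq_zero_of_notMem_tsupport fun h => hx (hχ.tsupport_subset h)
        simp [classicalConv, this]
    rw [key hψ hχ, key hχ hψ]
    exact integral_classicalConv_add hφ.contDiff hψ.contDiff hχ.contDiff hψ.hasCompactSupport
      hχ.hasCompactSupport

end SobolevSpace

/-! ### Bounds on the drift and absorption by the viscosity -/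

section DeterministicEstimate

variable {O : Set Plane}

lemma L4norm_nonneg (u : L2v O) : 0 ≤ L4norm u := ENNReal.toReal_nonneg

/-- The drift `-ν Δ U + [(U·∇) + ½ Div U] U + ∇ p` as a functional on `H¹₀`. -/
noncomputable def drift (ν : ℝ) (U : H10 O) (p : L2s O) : StrongDual ℝ (H10 O) :=
  ν • (innerSL ℝ U.grad).comp (gradL O) + convDual U U - (innerSL ℝ p).comp (divL O)

lemma drift_apply (ν : ℝ) (U : H10 O) (p : L2s O) (φ : H10 O) :
    drift ν U p φ = ν * inner ℝ U.grad φ.grad + convForm U U φ - pairDiv p φ := by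
  rw [convForm_eq, pairDiv_eq_inner]
  rfl

lemma continuous_drift (ν : ℝ) :
    Continuous fun z : H10 O × L2s O => drift ν z.1 z.2 := by
  have h1 : Continuous fun z : H10 O × L2s O => innerSL ℝ (gradL O z.1) := by fun_prop
  have h2 : Continuous fun z : H10 O × L2s O => innerSL ℝ z.2 := by fun_prop
  have h3 : Continuous fun z : H10 O × L2s O => convDual z.1 z.1 :=
    Continuous.comp (g := fun z : H10 O × H10 O => convDual z.1 z.2) continuous_convDual
      (continuous_fst.prodMk continuous_fst)
  have h4 : Continuous fun z : H10 O × L2s O => (innerSL ℝ (gradL O z.1)).comp (gradL O) :=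
    h1.clm_comp continuous_const
  have h5 : Continuous fun z : H10 O × L2s O => (innerSL ℝ z.2).comp (divL O) :=
    h2.clm_comp continuous_const
  exact ((h4.fun_const_smul ν).fun_add h3).fun_sub h5

attribute [irreducible] drift

/-- Ladyzhenskaya's constant 8 is rounded up to 9 to take an exact square root. -/
lemma L4norm_mul_L4norm_le (U V : H10 O) :
    L4norm U.val * L4norm V.val ≤ 3 * √(‖U.val‖ * ‖U‖) * √(‖V.val‖ * ‖V‖) := by
  have key : ∀ U : H10 O, L4norm U.val ^ 2 ≤ 3 * (‖U.val‖ * ‖U‖) := by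
    intro U
    refine le_of_sq_le_sq ?_ (by positivity)
    have h1 := L4norm_pow_four_le U
    have h2 := norm_grad_le U
    calc (L4norm U.val ^ 2) ^ 2 = L4norm U.val ^ 4 := by ring
      _ ≤ 8 * ‖U.val‖ ^ 2 * ‖U.grad‖ ^ 2 := h1
      _ ≤ 9 * ‖U.val‖ ^ 2 * ‖U‖ ^ 2 := by gcongr; norm_num
      _ = _ := by ring
  refine le_of_sq_le_sq ?_ (by positivity)
  rw [mul_pow, mul_pow, mul_pow, Real.sq_sqrt (by positivity), Real.sq_sqrt (by positivity)]
  calc L4norm U.val ^ 2 * L4norm V.val ^ 2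
      ≤ (3 * (‖U.val‖ * ‖U‖)) * (3 * (‖V.val‖ * ‖V‖)) := by
        gcongr
        exacts [key U, key V]
    _ = _ := by ring

/-- Interpolating both L⁴ norms isolates the factor `√‖φ.val‖` required by `energy_identity`; the L²
part of `U` is absorbed in `M`, leaving ‖U‖^{3/2} ‖φ‖^{1/2}. -/
lemma abs_convForm_self_le (U φ : H10 O) {M : ℝ} (hM : ‖U.val‖ ≤ M) :
    |convForm U U φ| ≤ √‖φ.val‖ * (6 * √M * (‖U‖ * √(‖U‖ * ‖φ‖))) := by
  have hM0 : 0 ≤ M := (norm_nonneg _).trans hM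
  have h0 : ∀ u : L2v O, 0 ≤ L4norm u := L4norm_nonneg
  calc |convForm U U φ|
      ≤ 2 * (‖U.grad‖ * (L4norm U.val * L4norm φ.val)) := by
        linarith [abs_convForm_le U U φ]
    _ ≤ 2 * (‖U‖ * (3 * √(M * ‖U‖) * √(‖φ.val‖ * ‖φ‖))) := by
        have := norm_grad_le U
        have := L4norm_mul_L4norm_le U φ
        have h3 : √(‖U.val‖ * ‖U‖) ≤ √(M * ‖U‖) := by gcongr
        have h4 : L4norm U.val * L4norm φ.val ≤ 3 * √(M * ‖U‖) * √(‖φ.val‖ * ‖φ‖) :=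
          this.trans (by gcongr)
        have h5 := mul_nonneg (h0 U.val) (h0 φ.val)
        exact mul_le_mul_of_nonneg_left (mul_le_mul ‹_› h4 h5 (norm_nonneg _)) two_pos.le
    _ = _ := by
        rw [Real.sqrt_mul hM0, Real.sqrt_mul (norm_nonneg _), Real.sqrt_mul (norm_nonneg _)]
        ring

lemma mul_sqrt_mul_le {c x y z : ℝ} (hc : 0 ≤ c) (hx : 0 ≤ x) (hy : 0 ≤ y)
    (hz : (c + 1) * x ≤ z) : c * (x * √(x * y)) ≤ z ^ 2 + y ^ 2 := by
  have h1 : √(x * y) ≤ (x + y) / 2 := by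
    rw [Real.sqrt_le_left (by positivity)]
    nlinarith [sq_nonneg (x - y)]
  have h2 : c * x ≤ z := by nlinarith
  have h3 : x ≤ z := by nlinarith
  have h4 : 0 ≤ z := hx.trans h3
  calc c * (x * √(x * y)) = (c * x) * √(x * y) := by ring
    _ ≤ z * ((z + y) / 2) := by gcongr; exact h1.trans (by linarith)
    _ ≤ _ := by nlinarith [sq_nonneg (z - y), sq_nonneg z, sq_nonneg y]

/-- With Z = U - V, trilinearity gives b(Z,U,Z) + b(V,Z,Z). Skewness kills the second term and turns
the first into -b(Z,Z,U), in which `U` is no longer differentiated. -/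
lemma convForm_sub_convForm (U V : H10 O) :
    convForm U U (U - V) - convForm V V (U - V) = -convForm (U - V) (U - V) U := by
  have h0 : ∀ A B : H10 O, convForm A B B = 0 := fun A B => by
    have := convForm_skew A B B
    linarith
  have h1 : convForm U U (U - V) - convForm V V (U - V) =
      convForm (U - V) U (U - V) + convForm V (U - V) (U - V) := by
    have e : ∀ A B : H10 O, (A - B).grad = A.grad - B.grad := fun A B => map_sub (gradL O) A B
    simp only [convForm_eq, convDual_apply, e, map_sub, inner_sub_left, inner_sub_right,
      sub_apply]
    ring
  rw [h1, h0, add_zero, convForm_skew]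

/-- Arithmetic-geometric inequality for x, x, x, y, that is 256 x³ y ≤ (3x + y)⁴. The choice 3x =
2νg² spends the whole dissipation, and the constant 27/ν³ in y makes 256 x³ y match Ladyzhenskaya's
8 exactly. -/
lemma four_mul_le_of_pow_le {ν g a b d : ℝ} (hν : 0 < ν) (h : b ^ 4 ≤ 8 * d ^ 2 * g ^ 2) :
    4 * (g * (b * a)) ≤ 2 * ν * g ^ 2 + 27 / ν ^ 3 * a ^ 4 * d ^ 2 := by
  set x : ℝ := 2 * ν * g ^ 2 / 3 with hx
  set y : ℝ := 27 / ν ^ 3 * a ^ 4 * d ^ 2 with hy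
  have hx0 : 0 ≤ x := by positivity
  have hy0 : 0 ≤ y := by positivity
  have h1 : 256 * x ^ 3 * y ≤ (3 * x + y) ^ 4 := by
    have : (3 * x + y) ^ 4 - 256 * x ^ 3 * y =
        (x - y) ^ 2 * (81 * x ^ 2 + 14 * (x * y) + y ^ 2) := by ring
    have h2 : 0 ≤ (x - y) ^ 2 * (81 * x ^ 2 + 14 * (x * y) + y ^ 2) := by positivity
    linarith
  have h2 : 256 * x ^ 3 * y = 256 * g ^ 4 * a ^ 4 * (8 * d ^ 2 * g ^ 2) := by
    rw [hx, hy]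
    field_simp
    ring
  have h3 : (4 * (g * (b * a))) ^ 4 ≤ (3 * x + y) ^ 4 := by
    calc (4 * (g * (b * a))) ^ 4 = 256 * g ^ 4 * a ^ 4 * b ^ 4 := by ring
      _ ≤ 256 * g ^ 4 * a ^ 4 * (8 * d ^ 2 * g ^ 2) := by gcongr
      _ ≤ _ := by rw [← h2]; exact h1
  have h4 := le_of_pow_le_pow_left₀ four_ne_zero (by positivity) h3
  have h5 : 3 * x = 2 * ν * g ^ 2 := by
    rw [hx]
    ring
  linarith

/-- The dissipation absorbs the convective term. -/
lemma dissipation_estimate {ν : ℝ} (hν : 0 < ν) (U V : H10 O) :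
    -2 * (ν * ‖(U - V).grad‖ ^ 2 + (convForm U U (U - V) - convForm V V (U - V))) ≤
      27 / ν ^ 3 * L4norm U.val ^ 4 * ‖(U - V).val‖ ^ 2 := by
  rw [convForm_sub_convForm]
  have h1 := abs_convForm_le (U - V) (U - V) U
  have h2 := four_mul_le_of_pow_le (a := L4norm U.val) hν (L4norm_pow_four_le (U - V))
  have h3 := le_abs_self (convForm (U - V) (U - V) U)
  linarith

lemma drift_sub_drift_apply (ν : ℝ) (U V φ : H10 O) (p q : L2s O) :
    (drift ν U p - drift ν V q) φ = ν * inner ℝ (U - V).grad φ.grad +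
      (convForm U U φ - convForm V V φ) - inner ℝ (p - q) (divL O φ) := by
  have e : (U - V).grad = U.grad - V.grad := map_sub (gradL O) _ _
  rw [sub_apply, drift_apply, drift_apply, e, inner_sub_left, inner_sub_left, pairDiv_eq_inner,
    pairDiv_eq_inner]
  ring

lemma abs_convForm_sub_le (U V φ : H10 O) {M β : ℝ} (hU : ‖U.val‖ ≤ M) (hV : ‖V.val‖ ≤ M)
    (hβ : (12 * √M + 1) * (‖U‖ + ‖V‖) ≤ β) :
    |convForm U U φ - convForm V V φ| ≤ √‖φ.val‖ * (β ^ 2 + ‖φ‖ ^ 2) := by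
  have c1 := abs_convForm_self_le U φ hU
  have c2 := abs_convForm_self_le V φ hV
  have hx : 0 ≤ ‖U‖ + ‖V‖ := by positivity
  have hxU : ‖U‖ ≤ ‖U‖ + ‖V‖ := le_add_of_nonneg_right (norm_nonneg _)
  have hxV : ‖V‖ ≤ ‖U‖ + ‖V‖ := le_add_of_nonneg_left (norm_nonneg _)
  generalize ‖U‖ + ‖V‖ = x at *
  generalize hy : ‖φ‖ = y at *
  have hy0 : 0 ≤ y := hy ▸ norm_nonneg _
  have c3 : ∀ z, 0 ≤ z → z ≤ x → √‖φ.val‖ * (6 * √M * (z * √(z * y))) ≤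
      √‖φ.val‖ * (6 * √M * (x * √(x * y))) := by
    intro z hz hzx
    gcongr
  have c4 : 12 * √M * (x * √(x * y)) ≤ β ^ 2 + y ^ 2 :=
    mul_sqrt_mul_le (by positivity) hx hy0 hβ
  calc |convForm U U φ - convForm V V φ| ≤ |convForm U U φ| + |convForm V V φ| := abs_sub _ _
    _ ≤ √‖φ.val‖ * (6 * √M * (x * √(x * y))) + √‖φ.val‖ * (6 * √M * (x * √(x * y))) :=
        add_le_add (c1.trans (c3 _ (norm_nonneg _) hxU)) (c2.trans (c3 _ (norm_nonneg _) hxV))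
    _ = √‖φ.val‖ * (12 * √M * (x * √(x * y))) := by ring
    _ ≤ _ := by gcongr

/-- This is the hypothesis of `energy_identity`, with a `β` linear in the norms of the data and
hence in L²(0,T). Viscosity and pressure enter through `β ‖φ‖`, convection through the square root
term. -/
lemma abs_drift_sub_drift_le {ν : ℝ} (hν : 0 < ν) (U V φ : H10 O) (p q : L2s O) {M : ℝ}
    (hU : ‖U.val‖ ≤ M) (hV : ‖V.val‖ ≤ M) :
    |(drift ν U p - drift ν V q) φ| ≤
      (ν * ‖U - V‖ + 2 * ‖p - q‖ + (12 * √M + 1) * (‖U‖ + ‖V‖)) * ‖φ‖ + √‖valL O φ‖ *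
        ((ν * ‖U - V‖ + 2 * ‖p - q‖ + (12 * √M + 1) * (‖U‖ + ‖V‖)) ^ 2 + ‖φ‖ ^ 2) := by
  have b1 : |ν * inner ℝ (U - V).grad φ.grad| ≤ ν * ‖U - V‖ * ‖φ‖ := by
    rw [abs_mul, abs_of_pos hν, mul_assoc]
    refine mul_le_mul_of_nonneg_left ((abs_real_inner_le_norm _ _).trans ?_) hν.le
    exact mul_le_mul (norm_grad_le _) (norm_grad_le _) (norm_nonneg _) (norm_nonneg _)
  have b2 : |inner ℝ (p - q) (divL O φ)| ≤ 2 * ‖p - q‖ * ‖φ‖ := by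
    refine (abs_real_inner_le_norm _ _).trans ?_
    have h1 := (norm_divL_apply_le φ).trans (mul_le_mul_of_nonneg_left (norm_grad_le φ) two_pos.le)
    have h2 := mul_le_mul_of_nonneg_left h1 (norm_nonneg (p - q))
    linarith
  have h0 : 0 ≤ (12 * √M + 1) * (‖U‖ + ‖V‖) := by positivity
  have h1 : 0 ≤ ν * ‖U - V‖ + 2 * ‖p - q‖ := by positivity
  have b3 := abs_convForm_sub_le U V φ hU hV
    (β := ν * ‖U - V‖ + 2 * ‖p - q‖ + (12 * √M + 1) * (‖U‖ + ‖V‖)) (by linarith)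
  have b4 := mul_nonneg h0 (norm_nonneg φ)
  rw [drift_sub_drift_apply, valL_apply]
  refine (abs_sub _ _).trans ((add_le_add (abs_add_le _ _) le_rfl).trans ?_)
  rw [add_mul _ _ ‖φ‖, add_mul _ _ ‖φ‖]
  linarith

lemma exists_norm_le_of_continuousOn {H : Type*} [NormedAddCommGroup H] {T : ℝ} {j u : ℝ → H}
    (hu : ContinuousOn u (Icc 0 T))
    (hju : ∀ᵐ s ∂(volume.restrict (Ioc 0 T)), j s = u s) :
    ∃ M, ∀ᵐ s ∂(volume.restrict (Ioc 0 T)), ‖j s‖ ≤ M := by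
  obtain ⟨M, hM⟩ := (isCompact_Icc (a := (0 : ℝ)) (b := T)).exists_bound_of_continuousOn hu
  refine ⟨M, ?_⟩
  filter_upwards [ae_restrict_mem measurableSet_Ioc, hju] with s hs h
  rw [h]
  exact hM s (Ioc_subset_Icc_self hs)

end DeterministicEstimate

/-! ### Energy balances of the velocity and of the pressure -/

section DeterministicEstimate

variable {O : Set Plane}

/-- The energy balance of the difference of two velocities. -/
lemma velocity_energy {T ν : ℝ} (hT : 0 < T) (hν : 0 < ν)
    {u v : ℝ → L2v O} {p q : ℝ → L2s O} {U V : ℝ → H10 O}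
    (hu : ContinuousOn u (Icc 0 T)) (hv : ContinuousOn v (Icc 0 T))
    (hU : MemLp U 2 (volume.restrict (Ioc 0 T))) (hV : MemLp V 2 (volume.restrict (Ioc 0 T)))
    (hUu : ∀ᵐ s ∂(volume.restrict (Ioc 0 T)), (U s).val = u s)
    (hVv : ∀ᵐ s ∂(volume.restrict (Ioc 0 T)), (V s).val = v s)
    (hp : MemLp p 2 (volume.restrict (Ioc 0 T))) (hq : MemLp q 2 (volume.restrict (Ioc 0 T)))
    (hmom : ∀ φ : H10 O, ∀ t ∈ Icc 0 T, inner ℝ (u t - v t) φ.val - inner ℝ (u 0 - v 0) φ.val +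
      ∫ s in (0 : ℝ)..t, (drift ν (U s) (p s) - drift ν (V s) (q s)) φ = 0) :
    Integrable (fun s => (drift ν (U s) (p s) - drift ν (V s) (q s)) (U s - V s))
      (volume.restrict (Ioc 0 T)) ∧ ∀ t ∈ Icc 0 T, ‖u t - v t‖ ^ 2 - ‖u 0 - v 0‖ ^ 2 +
        2 * ∫ s in (0 : ℝ)..t, (drift ν (U s) (p s) - drift ν (V s) (q s)) (U s - V s) = 0 := by
  obtain ⟨M₁, hM₁⟩ := exists_norm_le_of_continuousOn hu hUu
  obtain ⟨M₂, hM₂⟩ := exists_norm_le_of_continuousOn hv hVv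
  have hWm : MemLp (fun s => U s - V s) 2 (volume.restrict (Ioc 0 T)) := hU.sub hV
  have hWw : ∀ᵐ s ∂(volume.restrict (Ioc 0 T)), valL O (U s - V s) = u s - v s := by
    filter_upwards [hUu, hVv] with s h1 h2
    rw [map_sub, valL_apply, valL_apply, h1, h2]
  have hGm : AEStronglyMeasurable (fun s => drift ν (U s) (p s) - drift ν (V s) (q s))
      (volume.restrict (Ioc 0 T)) :=
    ((continuous_drift ν).comp_aestronglyMeasurable (hU.1.prodMk hp.1)).sub
      ((continuous_drift ν).comp_aestronglyMeasurable (hV.1.prodMk hq.1))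
  have hβm : MemLp (fun s => ν * ‖U s - V s‖ + 2 * ‖p s - q s‖ +
      (12 * √(max M₁ M₂) + 1) * (‖U s‖ + ‖V s‖)) 2 (volume.restrict (Ioc 0 T)) :=
    ((hWm.norm.const_mul ν).add ((hp.sub hq).norm.const_mul 2)).add
      ((hU.norm.add hV.norm).const_mul _)
  have hGβ : ∀ᵐ s ∂(volume.restrict (Ioc 0 T)), ∀ φ,
      |(drift ν (U s) (p s) - drift ν (V s) (q s)) φ| ≤ (ν * ‖U s - V s‖ + 2 * ‖p s - q s‖ +
        (12 * √(max M₁ M₂) + 1) * (‖U s‖ + ‖V s‖)) * ‖φ‖ + √‖valL O φ‖ *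
        ((ν * ‖U s - V s‖ + 2 * ‖p s - q s‖ +
          (12 * √(max M₁ M₂) + 1) * (‖U s‖ + ‖V s‖)) ^ 2 + ‖φ‖ ^ 2) := by
    filter_upwards [hM₁, hM₂] with s h1 h2 φ
    exact abs_drift_sub_drift_le hν _ _ _ _ _ (h1.trans (le_max_left _ _))
      (h2.trans (le_max_right _ _))
  obtain ⟨R, hR⟩ := exists_norm_le_of_continuousOn (hu.sub hv) hWw
  exact ⟨integrable_pairing_of_bound hWm hGm hβm hR hGβ, fun t ht =>
    energy_identity hT (hu.sub hv) hWm hGm hβm hGβ hWw hmom ht⟩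

/-- The chain rule for the squared norm of an absolutely continuous curve in a Hilbert space. -/
lemma norm_sq_primitive {H : Type*} [NormedAddCommGroup H] [InnerProductSpace ℝ H]
    [CompleteSpace H] {T : ℝ} (hT : 0 < T) {r d : ℝ → H}
    (hd : MemLp d 2 (volume.restrict (Ioc 0 T)))
    (hr : ∀ t ∈ Icc 0 T, r t = r 0 - ∫ s in (0 : ℝ)..t, d s) :
    Integrable (fun s => (inner ℝ (d s) (r s) : ℝ)) (volume.restrict (Ioc 0 T)) ∧
      ∀ t ∈ Icc 0 T, ‖r t‖ ^ 2 - ‖r 0‖ ^ 2 + 2 * ∫ s in (0 : ℝ)..t, inner ℝ (d s) (r s) = 0 := by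
  have hdi : ∀ t ∈ Icc 0 T, IntervalIntegrable d volume 0 t := by
    intro t ht
    rw [intervalIntegrable_iff_integrableOn_Ioc_of_le ht.1]
    exact IntegrableOn.mono_set (hd.integrable one_le_two) (Ioc_subset_Ioc_right ht.2)
  have hrc : ContinuousOn r (Icc 0 T) := by
    refine ContinuousOn.congr (continuousOn_const.sub ?_) hr
    have := intervalIntegral.continuousOn_primitive_interval' (b₁ := 0) (b₂ := T)
      (hdi T ⟨hT.le, le_rfl⟩) (a := 0) (by simp)
    rwa [uIcc_of_le hT.le] at this
  obtain ⟨R, hR⟩ := exists_norm_le_of_continuousOn hrc (Eventually.of_forall fun _ => rfl)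
  have hrm : MemLp r 2 (volume.restrict (Ioc 0 T)) :=
    MemLp.of_bound ((hrc.mono Ioc_subset_Icc_self).aestronglyMeasurable measurableSet_Ioc) R hR
  have hKm : AEStronglyMeasurable (fun s => innerSL ℝ (d s)) (volume.restrict (Ioc 0 T)) :=
    (innerSL ℝ).continuous.comp_aestronglyMeasurable hd.1
  have hKβ : ∀ᵐ s ∂(volume.restrict (Ioc 0 T)), ∀ φ, |innerSL ℝ (d s) φ| ≤ ‖d s‖ * ‖φ‖ +
      √‖ContinuousLinearMap.id ℝ H φ‖ * (‖d s‖ ^ 2 + ‖φ‖ ^ 2) := by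
    refine Eventually.of_forall fun s φ => ?_
    refine (abs_real_inner_le_norm _ _).trans (le_add_of_nonneg_right ?_)
    positivity
  -- The energy identity with `V = H` and `j` the identity, where the drift bound is purely linear.
  refine ⟨integrable_pairing_of_bound hrm hKm hd.norm hR hKβ, fun t ht =>
    energy_identity hT hrc hrm hKm hd.norm hKβ (Eventually.of_forall fun _ => rfl)
      (fun φ t ht => ?_) ht⟩
  have h1 : ∫ s in (0 : ℝ)..t, innerSL ℝ (d s) φ = inner ℝ (∫ s in (0 : ℝ)..t, d s) φ := by
    rw [real_inner_comm, ← innerSL_apply_apply (𝕜 := ℝ) φ,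
      ← ContinuousLinearMap.intervalIntegral_comp_comm _ (hdi t ht)]
    simp only [innerSL_apply_apply, real_inner_comm]
  rw [h1, hr t ht, ContinuousLinearMap.id_apply, inner_sub_left]
  ring

end DeterministicEstimate

/-! ### Pathwise stability estimate -/

section Stability

variable {O : Set Plane}

/-- By Ladyzhenskaya, ‖u‖₄⁴ is bounded by 8 sup|u|² times the squared H¹ norm, so the Grönwall rate
is integrable on every path of the energy class. -/
lemma integrable_L4norm_pow {T : ℝ} {u : ℝ → L2v O} {U : ℝ → H10 O}
    (hu : ContinuousOn u (Icc 0 T)) (hU : MemLp U 2 (volume.restrict (Ioc 0 T)))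
    (hUu : ∀ᵐ s ∂(volume.restrict (Ioc 0 T)), (U s).val = u s) :
    Integrable (fun s => L4norm (u s) ^ 4) (volume.restrict (Ioc 0 T)) := by
  obtain ⟨M, hM⟩ := exists_norm_le_of_continuousOn hu hUu
  have h1 : (fun s => ‖embL4 O (U s)‖ ^ 4) =ᵐ[volume.restrict (Ioc 0 T)]
      fun s => L4norm (u s) ^ 4 := by
    filter_upwards [hUu] with s hs
    rw [norm_embL4, hs]
  refine Integrable.congr ?_ h1
  refine Integrable.mono' ((hU.integrable_norm_pow two_ne_zero).const_mul (8 * M ^ 2))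
    (((embL4 O).continuous.comp_aestronglyMeasurable hU.1).norm.pow 4) ?_
  filter_upwards [hM] with s hs
  rw [norm_embL4, Real.norm_of_nonneg (pow_nonneg (L4norm_nonneg _) 4)]
  refine (L4norm_pow_four_le _).trans ?_
  gcongr
  exact norm_grad_le _

/-- The stability estimate for two solutions of the pathwise difference equations. -/
theorem stability_estimate {T ν ε : ℝ} (hT : 0 < T) (hν : 0 < ν) (hε : 0 < ε)
    {u v : ℝ → L2v O} {p q : ℝ → L2s O} {U V : ℝ → H10 O}
    (hu : ContinuousOn u (Icc 0 T)) (hv : ContinuousOn v (Icc 0 T))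
    (hU : MemLp U 2 (volume.restrict (Ioc 0 T))) (hV : MemLp V 2 (volume.restrict (Ioc 0 T)))
    (hUu : ∀ᵐ s ∂(volume.restrict (Ioc 0 T)), (U s).val = u s)
    (hVv : ∀ᵐ s ∂(volume.restrict (Ioc 0 T)), (V s).val = v s)
    (hp : MemLp p 2 (volume.restrict (Ioc 0 T))) (hq : MemLp q 2 (volume.restrict (Ioc 0 T)))
    (hmom : ∀ φ : H10 O, ∀ t ∈ Icc 0 T, inner ℝ (u t - v t) φ.val - inner ℝ (u 0 - v 0) φ.val +
      ∫ s in (0 : ℝ)..t, (drift ν (U s) (p s) - drift ν (V s) (q s)) φ = 0)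
    (hdiv : ∀ t ∈ Icc 0 T, ε • (p t - q t) + ∫ s in (0 : ℝ)..t, divL O (U s - V s) =
      ε • (p 0 - q 0))
    {t : ℝ} (ht : t ∈ Icc 0 T) :
    (‖u t - v t‖ ^ 2 + ε * ‖p t - q t‖ ^ 2) *
        Real.exp (-(27 / ν ^ 3) * ∫ s in (0 : ℝ)..t, L4norm (u s) ^ 4) ≤
      ‖u 0 - v 0‖ ^ 2 + ε * ‖p 0 - q 0‖ ^ 2 := by
  obtain ⟨hiG, hE1⟩ := velocity_energy hT hν hu hv hU hV hUu hVv hp hq hmom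
  have hdm : MemLp (fun s => ε⁻¹ • divL O (U s - V s)) 2 (volume.restrict (Ioc 0 T)) :=
    ((divL O).comp_memLp' (hU.sub hV)).const_smul ε⁻¹
  obtain ⟨hiK, hE2⟩ := norm_sq_primitive (r := fun s => p s - q s) hT hdm (fun t ht => by
    have h := hdiv t ht
    rw [← eq_sub_iff_add_eq] at h
    rw [intervalIntegral.integral_smul, ← inv_smul_smul₀ hε.ne' (p t - q t), h, smul_sub,
      inv_smul_smul₀ hε.ne'])
  set e : ℝ → ℝ := fun s =>
    -2 * ((drift ν (U s) (p s) - drift ν (V s) (q s)) (U s - V s)) +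
      -2 * ε * inner ℝ (ε⁻¹ • divL O (U s - V s)) (p s - q s) with he
  have hsub : ∀ t ∈ Icc 0 T, ∀ {f : ℝ → ℝ}, Integrable f (volume.restrict (Ioc 0 T)) →
      IntervalIntegrable f volume 0 t := by
    intro t ht f hf
    rw [intervalIntegrable_iff_integrableOn_Ioc_of_le ht.1]
    exact IntegrableOn.mono_set hf (Ioc_subset_Ioc_right ht.2)
  have hE : ∀ t ∈ Icc 0 T, ‖u t - v t‖ ^ 2 + ε * ‖p t - q t‖ ^ 2 =
      (‖u 0 - v 0‖ ^ 2 + ε * ‖p 0 - q 0‖ ^ 2) + ∫ s in (0 : ℝ)..t, e s := by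
    intro t ht
    have h1 := hE1 t ht
    have h2 := hE2 t ht
    simp only [he]
    rw [intervalIntegral.integral_add ((hsub t ht hiG).const_mul _) ((hsub t ht hiK).const_mul _),
      intervalIntegral.integral_const_mul, intervalIntegral.integral_const_mul]
    linear_combination h1 + ε * h2
  have hai : Integrable (fun s => 27 / ν ^ 3 * L4norm (u s) ^ 4) (volume.restrict (Ioc 0 T)) :=
    (integrable_L4norm_pow hu hU hUu).const_mul _
  -- The pressure work in the momentum balance cancels against the pressure balance, whose weight
  -- `ε` offsets the `ε⁻¹` in the pressure's rate.
  have hes : ∀ s, e s = -2 * (ν * ‖(U s - V s).grad‖ ^ 2 +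
      (convForm (U s) (U s) (U s - V s) - convForm (V s) (V s) (U s - V s))) := by
    intro s
    simp only [he]
    rw [drift_sub_drift_apply, real_inner_smul_left, real_inner_self_eq_norm_sq,
      real_inner_comm (p s - q s)]
    field_simp
    ring
  have hea : ∀ᵐ s, s ∈ Icc 0 t → e s ≤ 27 / ν ^ 3 * L4norm (u s) ^ 4 *
      ((‖u 0 - v 0‖ ^ 2 + ε * ‖p 0 - q 0‖ ^ 2) + ∫ r in (0 : ℝ)..s, e r) := by
    -- The identifications of `U` with `u` and `V` with `v` are given on `Ioc 0 T`, so the time 0 is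
    -- discarded.
    have hne : ∀ᵐ s : ℝ, s ≠ 0 := by simp [ae_iff]
    filter_upwards [(ae_restrict_iff' measurableSet_Ioc).1 hUu,
      (ae_restrict_iff' measurableSet_Ioc).1 hVv, hne] with s h1 h2 h3 hs
    have hsT : s ∈ Ioc 0 T := ⟨lt_of_le_of_ne hs.1 h3.symm, hs.2.trans ht.2⟩
    rw [← hE s (Ioc_subset_Icc_self hsT), hes]
    refine (dissipation_estimate hν (U s) (V s)).trans ?_
    have h4 : ‖(U s - V s).val‖ ^ 2 ≤ ‖u s - v s‖ ^ 2 + ε * ‖p s - q s‖ ^ 2 := by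
      have h5 : (U s - V s).val = u s - v s := by
        rw [← h1 hsT, ← h2 hsT]
        exact map_sub (valL O) _ _
      rw [h5]
      exact le_add_of_nonneg_right (by positivity)
    rw [h1 hsT]
    exact mul_le_mul_of_nonneg_left h4 (mul_nonneg (by positivity) (pow_nonneg (L4norm_nonneg _) 4))
  have hei : IntervalIntegrable e volume 0 t :=
    ((hsub t ht hiG).const_mul _).add ((hsub t ht hiK).const_mul _)
  have hfin := mul_exp_neg_integral_le ht.1 hei (hsub t ht hai) hea
  rw [← hE t ht, intervalIntegral.integral_const_mul, ← neg_mul] at hfin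
  exact hfin

end Stability

/-! ### From countably many test fields and times to all of them -/

section Pathwise

variable {O : Set Plane}

lemma secondCountableTopology_L2 {E : Type*} [NormedAddCommGroup E]
    [TopologicalSpace.SeparableSpace E] (O : Set Plane) :
    SecondCountableTopology (Lp E 2 (volume.restrict O)) :=
  haveI : Fact ((2 : ℝ≥0∞) ≠ ⊤) := ⟨by simp⟩
  Lp.SecondCountableTopology

lemma separableSpace_H10 (O : Set Plane) : TopologicalSpace.SeparableSpace (H10 O) := by
  have h1 : SecondCountableTopology (L2v O) := secondCountableTopology_L2 O
  have h2 : SecondCountableTopology (L2g O) := secondCountableTopology_L2 O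
  have h3 : SecondCountableTopology (WithLp 2 (L2v O × L2g O)) :=
    WithLp.secondCountableTopology 2 (L2v O) (L2g O)
  have h4 : SecondCountableTopology (H10 O) :=
    TopologicalSpace.Subtype.secondCountableTopology _
  infer_instance

lemma memLp_two_section {α β E : Type*} [MeasurableSpace α] [MeasurableSpace β]
    [NormedAddCommGroup E] {μ : Measure α} {ν : Measure β} [SFinite μ] [SFinite ν]
    {f : α × β → E} (hf : MemLp f 2 (μ.prod ν)) : ∀ᵐ x ∂μ, MemLp (fun y => f (x, y)) 2 ν := by
  filter_upwards [hf.1.prodMk_left,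
    ((memLp_two_iff_integrable_sq_norm hf.1).1 hf).prod_right_ae] with x h1 h2
  exact (memLp_two_iff_integrable_sq_norm h1).2 h2

lemma L4norm_le_two_mul_norm (U : H10 O) : L4norm U.val ≤ 2 * ‖U‖ := by
  refine le_of_pow_le_pow_left₀ four_ne_zero (by positivity) ((L4norm_pow_four_le U).trans ?_)
  calc 8 * ‖U.val‖ ^ 2 * ‖U.grad‖ ^ 2 ≤ 16 * ‖U‖ ^ 2 * ‖U‖ ^ 2 := by
        gcongr
        · norm_num
        · exact norm_val_le U
        · exact norm_grad_le U
    _ = _ := by ring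

/-- Quadratic in `U`, hence only integrable in time; that is enough to integrate the drift as a
dual-valued function. -/
lemma norm_drift_le (ν : ℝ) (U : H10 O) (p : L2s O) :
    ‖drift ν U p‖ ≤ |ν| * ‖U‖ + 8 * ‖U‖ ^ 2 + 2 * ‖p‖ := by
  refine ContinuousLinearMap.opNorm_le_bound _ (by positivity) fun φ => ?_
  rw [drift_apply, Real.norm_eq_abs]
  have b1 : |ν * inner ℝ U.grad φ.grad| ≤ |ν| * ‖U‖ * ‖φ‖ := by
    rw [abs_mul, mul_assoc]
    refine mul_le_mul_of_nonneg_left ((abs_real_inner_le_norm _ _).trans ?_) (abs_nonneg _)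
    exact mul_le_mul (norm_grad_le _) (norm_grad_le _) (norm_nonneg _) (norm_nonneg _)
  have b2 : |pairDiv p φ| ≤ 2 * ‖p‖ * ‖φ‖ := by
    rw [pairDiv_eq_inner]
    refine (abs_real_inner_le_norm _ _).trans ?_
    have h1 := (norm_divL_apply_le φ).trans (mul_le_mul_of_nonneg_left (norm_grad_le φ) two_pos.le)
    have h2 := mul_le_mul_of_nonneg_left h1 (norm_nonneg p)
    linarith
  have b3 : |convForm U U φ| ≤ 8 * ‖U‖ ^ 2 * ‖φ‖ := by
    have h1 : L4norm U.val * L4norm φ.val ≤ (2 * ‖U‖) * (2 * ‖φ‖) :=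
      mul_le_mul (L4norm_le_two_mul_norm U) (L4norm_le_two_mul_norm φ) (L4norm_nonneg _)
        (by positivity)
    have h2 : ‖U.grad‖ * (L4norm U.val * L4norm φ.val) ≤ ‖U‖ * ((2 * ‖U‖) * (2 * ‖φ‖)) :=
      mul_le_mul (norm_grad_le U) h1 (mul_nonneg (L4norm_nonneg _) (L4norm_nonneg _))
        (norm_nonneg _)
    linarith [abs_convForm_le U U φ]
  refine (abs_sub _ _).trans ((add_le_add (abs_add_le _ _) le_rfl).trans ?_)
  linarith

lemma aestronglyMeasurable_drift {μ : Measure ℝ} (ν : ℝ) {U : ℝ → H10 O}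
    {p : ℝ → L2s O} (hU : AEStronglyMeasurable U μ) (hp : AEStronglyMeasurable p μ) :
    AEStronglyMeasurable (fun s => drift ν (U s) (p s)) μ :=
  (continuous_drift ν).comp_aestronglyMeasurable (hU.prodMk hp)

lemma integrable_drift_bound {μ : Measure ℝ} [IsFiniteMeasure μ] (ν : ℝ) {U : ℝ → H10 O}
    {p : ℝ → L2s O} (hU : MemLp U 2 μ) (hp : MemLp p 2 μ) :
    Integrable (fun s => |ν| * ‖U s‖ + 8 * ‖U s‖ ^ 2 + 2 * ‖p s‖) μ :=
  (((hU.integrable one_le_two).norm.const_mul |ν|).add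
    ((hU.integrable_norm_pow two_ne_zero).const_mul 8)).add
    ((hp.integrable one_le_two).norm.const_mul 2)

lemma integrable_apply_of_norm_le {V : Type*} [NormedAddCommGroup V] [NormedSpace ℝ V]
    {μ : Measure ℝ} {D : ℝ → StrongDual ℝ V} {b : ℝ → ℝ} (hD : AEStronglyMeasurable D μ)
    (hb : Integrable b μ) (hDb : ∀ s, ‖D s‖ ≤ b s) (φ : V) : Integrable (fun s => D s φ) μ :=
  (hb.mono' hD (Eventually.of_forall hDb)).apply_continuousLinearMap φ

lemma integrable_apply_of_memLp_two {V : Type*} [NormedAddCommGroup V] [NormedSpace ℝ V]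
    {μ : Measure ℝ} [IsFiniteMeasure μ] {D : ℝ → StrongDual ℝ V} (hD : MemLp D 2 μ) (φ : V) :
    Integrable (fun s => D s φ) μ :=
  (hD.integrable one_le_two).apply_continuousLinearMap φ

lemma norm_dual_sub_le {V : Type*} [NormedAddCommGroup V] [NormedSpace ℝ V]
    {A B : StrongDual ℝ V} {a b : ℝ} (hA : ‖A‖ ≤ a) (hB : ‖B‖ ≤ b) : ‖A - B‖ ≤ a + b :=
  (norm_sub_le _ _).trans (add_le_add hA hB)

lemma intervalIntegrable_of_integrable {E : Type*} [NormedAddCommGroup E] {T t : ℝ} {F : ℝ → E}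
    (hF : Integrable F (volume.restrict (Ioc 0 T))) (ht : t ∈ Icc 0 T) :
    IntervalIntegrable F volume 0 t := by
  rw [intervalIntegrable_iff_integrableOn_Ioc_of_le ht.1]
  exact IntegrableOn.mono_set hF (Ioc_subset_Ioc_right ht.2)

/-- An evolution equation tested against a dense sequence at a dense sequence of times holds for
all test functions at all times. -/
lemma evolution_equation_of_dense {V H : Type*} [NormedAddCommGroup V] [NormedSpace ℝ V]
    [NormedAddCommGroup H] [InnerProductSpace ℝ H] {T : ℝ} (hT : 0 < T) (j : V →L[ℝ] H)
    {a : ℝ → H} {D : ℝ → StrongDual ℝ V} (ha : ContinuousOn a (Icc 0 T))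
    {b : ℝ → ℝ} (hDm : AEStronglyMeasurable D (volume.restrict (Ioc 0 T)))
    (hb : Integrable b (volume.restrict (Ioc 0 T))) (hDb : ∀ s, ‖D s‖ ≤ b s) {φ : ℕ → V}
    (hφ : DenseRange φ)
    {τ : ℕ → Icc 0 T} (hτ : DenseRange τ)
    (h : ∀ n m, inner ℝ (a (τ m)) (j (φ n)) - inner ℝ (a 0) (j (φ n)) +
      ∫ s in (0 : ℝ)..τ m, D s (φ n) = 0) (ψ : V) {t : ℝ} (ht : t ∈ Icc 0 T) :
    inner ℝ (a t) (j ψ) - inner ℝ (a 0) (j ψ) + ∫ s in (0 : ℝ)..t, D s ψ = 0 := by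
  have hD : Integrable D (volume.restrict (Ioc 0 T)) :=
    hb.mono' hDm (Eventually.of_forall hDb)
  have hDi := fun t (ht : t ∈ Icc 0 T) => intervalIntegrable_of_integrable hD ht
  -- Integrating `D` in the dual space makes the equation continuous in the time and in the test
  -- function, so density in each variable suffices.
  have hprim : ContinuousOn (fun t => ∫ s in (0 : ℝ)..t, D s) (Icc 0 T) := by
    have := intervalIntegral.continuousOn_primitive_interval' (b₁ := 0) (b₂ := T)
      (hDi T ⟨hT.le, le_rfl⟩) (a := 0) (by simp)
    rwa [uIcc_of_le hT.le] at this
  have ha' : Continuous fun t : Icc 0 T => a t := continuousOn_iff_continuous_domRestrict.1 ha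
  have hp' : Continuous fun t : Icc 0 T => ∫ s in (0 : ℝ)..t, D s :=
    continuousOn_iff_continuous_domRestrict.1 hprim
  have h1 : ∀ n, (fun t : Icc 0 T => inner ℝ (a t) (j (φ n)) - inner ℝ (a 0) (j (φ n)) +
      (∫ s in (0 : ℝ)..t, D s) (φ n)) = fun _ => 0 := by
    intro n
    refine hτ.equalizer (((ha'.inner continuous_const).sub continuous_const).add
      (hp'.clm_apply continuous_const)) continuous_const ?_
    funext m
    simp only [Function.comp_apply]
    rw [ContinuousLinearMap.intervalIntegral_apply (hDi _ (τ m).2)]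
    exact h n m
  have h2 : (fun ψ : V => inner ℝ (a t) (j ψ) - inner ℝ (a 0) (j ψ) +
      (∫ s in (0 : ℝ)..t, D s) ψ) = fun _ => 0 := by
    refine hφ.equalizer (by fun_prop) continuous_const ?_
    funext n
    exact congrFun (h1 n) ⟨t, ht⟩
  rw [← ContinuousLinearMap.intervalIntegral_apply (hDi _ ht)]
  exact congrFun h2 ψ

end Pathwise

/-! ### Pathwise equations for the difference of two solutions -/

section Solutions

variable {O : Set Plane} {Ω : Type*} [mΩ : MeasurableSpace Ω] {P : Measure Ω}
  {ℱ : Filtration ℝ≥0 mΩ} {w : ℕ → ℝ≥0 → Ω → ℝ} {T ν ε : ℝ}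
  {f : ℝ → StrongDual ℝ (H10 O)} {g : ℝ → lp (fun _ : ℕ => L2v O) 2}
  {u v : ℝ → Ω → L2v O} {p q : ℝ → Ω → L2s O}

/-- The pathwise form of the pressure equation. -/
lemma ae_pressure_equation {U : ℝ → Ω → H10 O}
    (hU : ∀ᵐ ω ∂P, Integrable (fun s => U s ω) (volume.restrict (Ioc 0 T)))
    (h : ∀ η : L2s O, ∀ᵐ ω ∂P, ∀ t ∈ Icc (0 : ℝ) T,
      ε * inner ℝ (p t ω) η + ∫ s in (0 : ℝ)..t, pairDiv η (U s ω) = ε * inner ℝ (p 0 ω) η) :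
    ∀ᵐ ω ∂P, ∀ t ∈ Icc (0 : ℝ) T,
      ε • p t ω + ∫ s in (0 : ℝ)..t, divL O (U s ω) = ε • p 0 ω := by
  have : SecondCountableTopology (L2s O) := secondCountableTopology_L2 O
  filter_upwards [hU, ae_all_iff.2 fun n => h (TopologicalSpace.denseSeq (L2s O) n)]
    with ω hω hn t ht
  have hi : IntervalIntegrable (fun s => divL O (U s ω)) volume 0 t :=
    intervalIntegrable_of_integrable ((divL O).integrable_comp hω) ht
  refine ext_inner_left ℝ fun η => ?_
  have key : (fun η : L2s O => inner ℝ η (ε • p t ω + ∫ s in (0 : ℝ)..t, divL O (U s ω))) =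
      fun η => inner ℝ η (ε • p 0 ω) := by
    refine (TopologicalSpace.denseRange_denseSeq (L2s O)).equalizer (by fun_prop) (by fun_prop) ?_
    funext n
    have h1 := hn n t ht
    rw [Function.comp_apply, Function.comp_apply]
    generalize TopologicalSpace.denseSeq (L2s O) n = η at h1 ⊢
    simp only [pairDiv_eq_inner] at h1
    have h2 : ∫ s in (0 : ℝ)..t, (inner ℝ η (divL O (U s ω)) : ℝ) =
        inner ℝ η (∫ s in (0 : ℝ)..t, divL O (U s ω)) :=
      (innerSL ℝ η).intervalIntegral_comp_comm hi
    rw [h2, real_inner_comm, real_inner_comm η] at h1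
    change inner ℝ η (ε • p t ω + ∫ s in (0 : ℝ)..t, divL O (U s ω)) = inner ℝ η (ε • p 0 ω)
    rw [inner_add_right, real_inner_smul_right, real_inner_smul_right]
    exact h1
  exact congrFun key η

/-- The pathwise momentum equation for the difference of two solutions. -/
lemma ae_momentum_equation_sub [IsProbabilityMeasure P] (hw : IsWienerFamily P ℱ w) (hT : 0 < T)
    (hf : ∀ φ, Integrable (fun s => f s φ) (volume.restrict (Ioc 0 T)))
    (hg : MemLp g 2 (volume.restrict (Ioc 0 T)))
    (huc : ∀ᵐ ω ∂P, ContinuousOn (fun t => u t ω) (Icc 0 T))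
    (hvc : ∀ᵐ ω ∂P, ContinuousOn (fun t => v t ω) (Icc 0 T))
    {U V : ℝ → Ω → H10 O}
    (hU : ∀ᵐ ω ∂P, MemLp (fun s => U s ω) 2 (volume.restrict (Ioc 0 T)))
    (hp : ∀ᵐ ω ∂P, MemLp (fun s => p s ω) 2 (volume.restrict (Ioc 0 T)))
    (hV : ∀ᵐ ω ∂P, MemLp (fun s => V s ω) 2 (volume.restrict (Ioc 0 T)))
    (hq : ∀ᵐ ω ∂P, MemLp (fun s => q s ω) 2 (volume.restrict (Ioc 0 T)))
    (hu : ∀ φ : H10 O, ∀ t : ℝ≥0, (t : ℝ) ≤ T →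
      IsItoIntegral P w (fun k s => inner ℝ (g s k) φ.val) t
        (fun ω => inner ℝ (u t ω) φ.val - inner ℝ (u 0 ω) φ.val +
          ∫ s in (0 : ℝ)..t, (ν * inner ℝ (U s ω).grad φ.grad +
            convForm (U s ω) (U s ω) φ - pairDiv (p s ω) φ - f s φ)))
    (hv : ∀ φ : H10 O, ∀ t : ℝ≥0, (t : ℝ) ≤ T →
      IsItoIntegral P w (fun k s => inner ℝ (g s k) φ.val) t
        (fun ω => inner ℝ (v t ω) φ.val - inner ℝ (v 0 ω) φ.val +
          ∫ s in (0 : ℝ)..t, (ν * inner ℝ (V s ω).grad φ.grad +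
            convForm (V s ω) (V s ω) φ - pairDiv (q s ω) φ - f s φ))) :
    ∀ᵐ ω ∂P, ∀ φ : H10 O, ∀ t ∈ Icc 0 T,
      inner ℝ (u t ω - v t ω) φ.val - inner ℝ (u 0 ω - v 0 ω) φ.val +
        ∫ s in (0 : ℝ)..t, (drift ν (U s ω) (p s ω) - drift ν (V s ω) (q s ω)) φ = 0 := by
  have := separableSpace_H10 O
  have : Nonempty (Icc 0 T) := ⟨⟨0, le_rfl, hT.le⟩⟩
  set τ := TopologicalSpace.denseSeq (Icc 0 T) with hτ
  set ψ := TopologicalSpace.denseSeq (H10 O) with hψ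
  have hgm : ∀ (φ : H10 O) (t : ℝ≥0), (t : ℝ) ≤ T → ∀ k,
      AEMeasurable (fun s => (inner ℝ (g s k) φ.val : ℝ)) (volume.restrict (Ioc 0 (t : ℝ))) := by
    intro φ t ht k
    have h1 : AEStronglyMeasurable (fun s => g s k) (volume.restrict (Ioc 0 T)) :=
      (lp.evalCLM ℝ (fun _ : ℕ => L2v O) 2 k).continuous.comp_aestronglyMeasurable hg.1
    exact ((h1.mono_measure (Measure.restrict_mono (Ioc_subset_Ioc_right ht) le_rfl)).inner
      aestronglyMeasurable_const).aemeasurable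
  have hall : ∀ᵐ ω ∂P, ∀ n m,
      inner ℝ (u (τ m) ω) (ψ n).val - inner ℝ (u 0 ω) (ψ n).val +
          ∫ s in (0 : ℝ)..τ m, (ν * inner ℝ (U s ω).grad (ψ n).grad +
            convForm (U s ω) (U s ω) (ψ n) - pairDiv (p s ω) (ψ n) - f s (ψ n)) =
      inner ℝ (v (τ m) ω) (ψ n).val - inner ℝ (v 0 ω) (ψ n).val +
          ∫ s in (0 : ℝ)..τ m, (ν * inner ℝ (V s ω).grad (ψ n).grad +
            convForm (V s ω) (V s ω) (ψ n) - pairDiv (q s ω) (ψ n) - f s (ψ n)) := by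
    -- For each test field and time, both sides are versions of one Itô integral; this removes the
    -- noise outside a countable union of null sets.
    refine ae_all_iff.2 fun n => ae_all_iff.2 fun m => ?_
    exact IsItoIntegral.ae_eq hw (hgm (ψ n) ⟨τ m, (τ m).2.1⟩ (τ m).2.2)
      (hu (ψ n) ⟨τ m, (τ m).2.1⟩ (τ m).2.2) (hv (ψ n) ⟨τ m, (τ m).2.1⟩ (τ m).2.2)
  filter_upwards [huc, hvc, hU, hp, hV, hq, hall] with ω h1 h2 hU hp hV hq h5 φ t ht
  have mU := aestronglyMeasurable_drift ν hU.1 hp.1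
  have mV := aestronglyMeasurable_drift ν hV.1 hq.1
  have bU := integrable_drift_bound ν hU hp
  have bV := integrable_drift_bound ν hV hq
  refine evolution_equation_of_dense hT (valL O) (a := fun t => u t ω - v t ω)
    (D := fun s => drift ν (U s ω) (p s ω) - drift ν (V s ω) (q s ω)) (h1.sub h2)
    (mU.sub mV) (bU.add bV) (fun s =>
      norm_dual_sub_le (norm_drift_le ν _ _) (norm_drift_le ν _ _))
    (TopologicalSpace.denseRange_denseSeq (H10 O)) (TopologicalSpace.denseRange_denseSeq (Icc 0 T))
    (fun n m => ?_) φ ht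
  have h6 := h5 n m
  have h3 : IntervalIntegrable (fun s => drift ν (U s ω) (p s ω) (ψ n)) volume 0 (τ m) :=
    intervalIntegrable_of_integrable (integrable_apply_of_norm_le mU bU
      (fun s => norm_drift_le ν _ _) (ψ n)) (τ m).2
  have h4 : IntervalIntegrable (fun s => drift ν (V s ω) (q s ω) (ψ n)) volume 0 (τ m) :=
    intervalIntegrable_of_integrable (integrable_apply_of_norm_le mV bV
      (fun s => norm_drift_le ν _ _) (ψ n)) (τ m).2
  have hfi : IntervalIntegrable (fun s => f s (ψ n)) volume 0 (τ m) :=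
    intervalIntegrable_of_integrable (hf (ψ n)) (τ m).2
  simp only [← drift_apply] at h6
  rw [intervalIntegral.integral_sub h3 hfi, intervalIntegral.integral_sub h4 hfi] at h6
  simp only [sub_apply]
  rw [intervalIntegral.integral_sub h3 h4, inner_sub_left, inner_sub_left]
  simp only [valL_apply]
  linarith

/-- Two solutions satisfy the stability estimate along almost every path. -/
theorem IsSolution.ae_stability [IsProbabilityMeasure P] (hw : IsWienerFamily P ℱ w) (hT : 0 < T)
    (hν : 0 < ν) (hε : 0 < ε) (hf : MemLp f 2 (volume.restrict (Ioc 0 T)))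
    (hg : MemLp g 2 (volume.restrict (Ioc 0 T)))
    (hu : IsSolution P ℱ w T ν ε f g u p) (hv : IsSolution P ℱ w T ν ε f g v q) :
    ∀ᵐ ω ∂P, ∀ t ∈ Icc (0 : ℝ) T,
      (‖u t ω - v t ω‖ ^ 2 + ε * ‖p t ω - q t ω‖ ^ 2) *
          Real.exp (-(27 / ν ^ 3) * ∫ s in (0 : ℝ)..t, L4norm (u s ω) ^ 4) ≤
        ‖u 0 ω - v 0 ω‖ ^ 2 + ε * ‖p 0 ω - q 0 ω‖ ^ 2 := by
  obtain ⟨U, hU, hUu, hUmom, hUp⟩ := hu.equations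
  obtain ⟨V, hV, hVv, hVmom, hVq⟩ := hv.equations
  have sU := memLp_two_section hU
  have sV := memLp_two_section hV
  have sp := memLp_two_section hu.memLp_p
  have sq := memLp_two_section hv.memLp_p
  have hmom := ae_momentum_equation_sub hw hT (integrable_apply_of_memLp_two hf) hg
    hu.continuous_u hv.continuous_u sU sp sV sq hUmom hVmom
  have hp := ae_pressure_equation
    (by filter_upwards [sU] with ω h using h.integrable one_le_two) hUp
  have hq := ae_pressure_equation
    (by filter_upwards [sV] with ω h using h.integrable one_le_two) hVq
  filter_upwards [hu.continuous_u, hv.continuous_u, sU, sV, Measure.ae_ae_of_ae_prod hUu,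
    Measure.ae_ae_of_ae_prod hVv, sp, sq, hmom, hp, hq]
    with ω h1 h2 h3 h4 h5 h6 h7 h8 h9 h10 h11 t ht
  refine stability_estimate hT hν hε h1 h2 h3 h4 h5 h6 h7 h8 h9 (fun t ht => ?_) ht
  have hi : ∀ {W : ℝ → H10 O}, MemLp W 2 (volume.restrict (Ioc 0 T)) →
      IntervalIntegrable (fun s => divL O (W s)) volume 0 t := fun hW =>
    intervalIntegrable_of_integrable ((divL O).integrable_comp (hW.integrable one_le_two)) ht
  simp only [map_sub]
  rw [intervalIntegral.integral_sub (hi h3) (hi h4), smul_sub, smul_sub, ← h10 t ht, ← h11 t ht]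
  abel

end Solutions

end ArtComp

theorem proposition3p2
    {Ω : Type*} [mΩ : MeasurableSpace Ω] (P : Measure Ω) [IsProbabilityMeasure P]
    (ℱ : Filtration ℝ≥0 mΩ) (w : ℕ → ℝ≥0 → Ω → ℝ) (hw : IsWienerFamily P ℱ w)
    (O : Set Plane) (hO : IsOpen O) (hOb : Bornology.IsBounded O)
    (T ν ε : ℝ) (hT : 0 < T) (hν : 0 < ν) (hε : 0 < ε)
    (f : ℝ → StrongDual ℝ (H10 O)) (hf : MemLp f 2 (volume.restrict (Ioc 0 T)))
    (g : ℝ → lp (fun _ : ℕ => L2v O) 2) (hg : MemLp g 2 (volume.restrict (Ioc 0 T)))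
    (u v : ℝ → Ω → L2v O) (p q : ℝ → Ω → L2s O)
    (hu : IsSolution P ℱ w T ν ε f g u p) (hv : IsSolution P ℱ w T ν ε f g v q) :
    ((∫⁻ ω, (∫⁻ t in Ioc 0 T, eL4norm (u t ω) ^ 4) ∂P) < ⊤ →
      ∀ᵐ ω ∂P, ∀ t ∈ Icc (0 : ℝ) T,
        (‖u t ω - v t ω‖ ^ 2 + ε * ‖p t ω - q t ω‖ ^ 2) *
            Real.exp (-(27 / ν ^ 3) * ∫ s in (0 : ℝ)..t, L4norm (u s ω) ^ 4) ≤
          ‖u 0 ω - v 0 ω‖ ^ 2 + ε * ‖p 0 ω - q 0 ω‖ ^ 2) ∧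
    ((∀ᵐ ω ∂P, u 0 ω = v 0 ω ∧ p 0 ω = q 0 ω) →
      ∀ᵐ ω ∂P, ∀ t ∈ Icc (0 : ℝ) T, u t ω = v t ω ∧ p t ω = q t ω) := by
  have key := IsSolution.ae_stability hw hT hν hε hf hg hu hv
  refine ⟨fun _ => key, fun h0 => ?_⟩
  filter_upwards [key, h0] with ω h1 h2 t ht
  have h3 := h1 t ht
  rw [h2.1, h2.2] at h3
  simp only [sub_self, norm_zero, ne_eq, OfNat.ofNat_ne_zero, not_false_eq_true, zero_pow,
    mul_zero, add_zero] at h3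
  have h4 := nonpos_of_mul_nonpos_left h3 (Real.exp_pos _)
  have h5 : 0 ≤ ‖u t ω - v t ω‖ ^ 2 := by positivity
  have h6 : 0 ≤ ε * ‖p t ω - q t ω‖ ^ 2 := by positivity
  have h7 : ‖u t ω - v t ω‖ ^ 2 = 0 := by linarith
  have h8 : ε * ‖p t ω - q t ω‖ ^ 2 = 0 := by linarith
  constructor
  · exact sub_eq_zero.1 (norm_eq_zero.1 (pow_eq_zero_iff two_ne_zero |>.1 h7))
  · rw [mul_eq_zero, or_iff_right hε.ne'] at h8
    exact sub_eq_zero.1 (norm_eq_zero.1 (pow_eq_zero_iff two_ne_zero |>.1 h8))
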